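/- Let $\tau$ be in the upper half-plane, $\Lambda=\mathbb{Z}+\mathbb{Z}\tau$, let $\wp$, $\zeta$ be the Weierstrass functions of $\Lambda$ and $g_2,g_3$ its invariants, and let $\gamma$ be the segment from $\tau/2$ to $\tau/2+1$. An elliptic polynomial is an elliptic function with periods $1,\tau$ whose poles all lie on $\Lambda$; it is monic of degree $n$ if it equals $z^{-n}(1+\mathcal{O}(z))$ as $z\to0$. Let $(\pi_n)_{n\ge 0,\,n\ne 1}$ be a sequence of elliptic orthogonal polynomials for the weight $1$: $\pi_n$ is a monic elliptic polynomial of degree $n$ and $\int_\gamma \pi_m\pi_n\,dz=\delta_{mn}h_n$ for all $m,n\neq 1$. Assume $h_n\neq 0$ for all $n\ne1$. Define $c_{j,n}$ and (for $n\ge 2$) $\widetilde c_{j,n}$ by the expansions, as $z\to 0$, $$\pi_n(z)=\sum_{j\ge 0} c_{j,n}\,z^{j-n},\qquad \int_\gamma \pi_n(w)\bigl(\zeta(w-z)-\zeta(w)\bigr)\frac{dw}{2\pi i}=\frac{h_n}{2\pi i}\sum_{j\ge 0}\widetilde c_{j,n}\,z^{n+j-1},$$ and, for $n\ge 3$, set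 $\beta_n=h_n/h_{n-1}$ and $\alpha_n=c_{2,n}+\widetilde c_{2,n-1}-\beta_n$. Then for every $n\ge 4$ $$\pi_{n+2}=(\wp-B_n)\,\pi_n-\beta_n\beta_{n-1}\,\pi_{n-2},\qquad B_n=\beta_{n+1}+\beta_n+\alpha_n+\alpha_{n+1},$$ and $$-\alpha_n^3+\frac{g_2}{4}\alpha_n-\frac{g_3}{4}=\beta_n(\alpha_{n-1}-\alpha_n)(\alpha_{n+1}-\alpha_n).$$ -/

import Mathlib

open Filter Topology Asymptotics

noncomputable section

namespace EllipticOP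

/-- The period pair `(1, τ)`, for `τ` in the upper half-plane; its lattice is `ℤ + ℤ τ`. -/
def periods (τ : UpperHalfPlane) : PeriodPair where
  ω₁ := 1
  ω₂ := τ
  indep := by
    rw [LinearIndependent.pair_iff]
    intro s t h
    have him := congrArg Complex.im h
    have ht : t = 0 := by
      simpa [τ.im_ne_zero] using him
    subst ht
    have hre := congrArg Complex.re h
    simpa using hre

/-- The Weierstrass function `℘` of the lattice `ℤ + ℤ τ`. -/
def wp (τ : UpperHalfPlane) : ℂ → ℂ := (periods τ).weierstrassP

/-- The Weierstrass zeta function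
`ζ(z) = 1/z + ∑_{l ≠ 0} (1/(z - l) + 1/l + z/l²)` of the lattice `ℤ + ℤ τ`.
The summand at `l = 0` is `1/z`, because `x / 0 = 0`. -/
def wzeta (τ : UpperHalfPlane) (z : ℂ) : ℂ :=
  ∑' l : (periods τ).lattice, (1 / (z - l) + 1 / (l : ℂ) + z / (l : ℂ) ^ 2)

/-- Elliptic polynomials: elliptic functions with periods `1` and `τ` whose poles all lie on the
lattice `ℤ + ℤ τ`. (The values that the function takes on the lattice carry no information.) -/
structure IsEllipticPolynomial (τ : UpperHalfPlane) (f : ℂ → ℂ) : Prop where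
  meromorphic : Meromorphic f
  differentiableOn : DifferentiableOn ℂ f ((periods τ).lattice : Set ℂ)ᶜ
  periodic_one : Function.Periodic f 1
  periodic_tau : Function.Periodic f (τ : ℂ)

/-- `f(z) = z⁻ⁿ (1 + O(z))` as `z → 0`. -/
def IsMonicOfDegree (n : ℕ) (f : ℂ → ℂ) : Prop :=
  (fun z : ℂ => z ^ n * f z - 1) =O[𝓝[≠] 0] (fun z : ℂ => z)

/-- The integral of `f` along the segment `γ` from `τ/2` to `τ/2 + 1`. -/
def gammaIntegral (τ : UpperHalfPlane) (f : ℂ → ℂ) : ℂ :=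
  ∫ t in (0 : ℝ)..1, f ((τ : ℂ) / 2 + t)

/-- `(π_n)_{n ≥ 0, n ≠ 1}` is a sequence of elliptic orthogonal polynomials for the constant
weight `1` on `γ`. The entry `π 1` plays no role. -/
structure IsEOP (τ : UpperHalfPlane) (π : ℕ → ℂ → ℂ) : Prop where
  isEllipticPolynomial : ∀ n, n ≠ 1 → IsEllipticPolynomial τ (π n)
  monic : ∀ n, n ≠ 1 → IsMonicOfDegree n (π n)
  orthogonal : ∀ m n, m ≠ 1 → n ≠ 1 → m ≠ n →
    gammaIntegral τ (fun z => π m z * π n z) = 0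

/-- The square norms `h_n = ∫_γ π_n(z)² dz`. -/
def h (τ : UpperHalfPlane) (π : ℕ → ℂ → ℂ) (n : ℕ) : ℂ :=
  gammaIntegral τ (fun z => π n z ^ 2)

/-- The Cauchy transform `C(f)(z) = ∫_γ f(w) (ζ(w - z) - ζ(w)) dw / (2πi)`. -/
def cauchyTransform (τ : UpperHalfPlane) (f : ℂ → ℂ) (z : ℂ) : ℂ :=
  gammaIntegral τ (fun w => f w * (wzeta τ (w - z) - wzeta τ w)) / (2 * Real.pi * Complex.I)

/-- The `j`-th Taylor coefficient at `0` of a function with a removable singularity at `0`: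
the value at `0` is replaced by the limit there. -/
def taylorCoeff (g : ℂ → ℂ) (j : ℕ) : ℂ :=
  iteratedDeriv j (Function.update g 0 (limUnder (𝓝[≠] (0 : ℂ)) g)) 0 / (j.factorial : ℂ)

/-- The coefficients in `π_n(z) = ∑_j c_{j,n} z^(j - n)` near `0`. -/
def c (π : ℕ → ℂ → ℂ) (j n : ℕ) : ℂ :=
  taylorCoeff (fun z => z ^ n * π n z) j

/-- The coefficients in `C(π_n)(z) = (h_n / (2πi)) ∑_j c̃_{j,n} z^(n + j - 1)` near `0`. -/
def cTilde (τ : UpperHalfPlane) (π : ℕ → ℂ → ℂ) (j n : ℕ) : ℂ :=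
  taylorCoeff (fun z => (2 * Real.pi * Complex.I / h τ π n) *
    (cauchyTransform τ (π n) z / z ^ (n - 1))) j

/-- `β_n = h_n / h_{n-1}`. -/
def β (τ : UpperHalfPlane) (π : ℕ → ℂ → ℂ) (n : ℕ) : ℂ :=
  h τ π n / h τ π (n - 1)

/-- `α_n = c_{2,n} + c̃_{2,n-1} - β_n`. -/
def α (τ : UpperHalfPlane) (π : ℕ → ℂ → ℂ) (n : ℕ) : ℂ :=
  c π 2 n + cTilde τ π 2 (n - 1) - β τ π n

/-- `B_n = β_{n+1} + β_n + α_n + α_{n+1}`. -/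
def B (τ : UpperHalfPlane) (π : ℕ → ℂ → ℂ) (n : ℕ) : ℂ :=
  β τ π (n + 1) + β τ π n + α τ π n + α τ π (n + 1)

end EllipticOP

end

/-! Reflection in the midpoint of `γ`, combined with periodicity, preserves `∫_γ`; together with
`h_n ≠ 0` this gives `π_n` the parity of `n`. Hence `π_n = z⁻ⁿ(1 + c_{2,n} z² + O(z³))`, and
pairings with `π_m` can be read off from pole orders and the `z²` coefficient
(`innerInt_of_hasExpansion`).

Since `ζ' = -℘`, the Taylor coefficients of the Cauchy transform are pairings of `π_n` with
normalized derivatives of `℘`. This gives `c̃_{2,n} = -c_{2,n+2}` (`cTilde_two`), so `α_n = c_{2,n}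
- c_{2,n+1} - β_n` and `B_n = c_{2,n} - c_{2,n+2}`.

An elliptic polynomial of degree at most `d` orthogonal to all `π_m`, `m ≤ d`, is zero off the
lattice. Testing this way proves `recurrence` and, with `D = -℘'/2`, the relation `D π_n = (℘ + α_n)
π_{n+1} + β_n (℘ + α_{n+1}) π_{n-1}` (`halfDeriv_mul`). Applying the latter twice and removing
`π_{n±2}` by the recurrence gives `D² π_n` as a polynomial in `℘` times `π_n`, while `D² = ℘³ -
(g₂/4) ℘ - g₃/4`. As `℘` is unbounded, the two polynomials coincide; at `-α_n` they yield the cubic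
relation. -/

noncomputable section

namespace EllipticOP

/-! ### Removable singularities and punctured neighbourhoods of `0`. -/

section Removable

lemma exists_analyticAt_of_isBigO_one {u : ℂ → ℂ} {x : ℂ}
    (hd : ∀ᶠ z in 𝓝[≠] x, DifferentiableAt ℂ u z)
    (hb : u =O[𝓝[≠] x] (fun _ => (1 : ℂ))) :
    ∃ v, AnalyticAt ℂ v x ∧ u =ᶠ[𝓝[≠] x] v := by
  have hlim := Complex.tendsto_limUnder_of_differentiable_on_punctured_nhds_of_bounded_under hd
    (by
      have : (fun z => u z - u x) =O[𝓝[≠] x] (fun _ => (1 : ℂ)) :=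
        hb.sub (isBigO_const_const _ one_ne_zero _)
      exact (isBigO_one_iff ℂ).1 this)
  set a := limUnder (𝓝[≠] x) u
  have hcongr : ∀ z, z ≠ x → Function.update u x a =ᶠ[𝓝 z] u := fun z hz => by
    filter_upwards [isOpen_ne.mem_nhds hz] with w hw
    exact Function.update_of_ne hw _ _
  refine ⟨Function.update u x a, ?_, ?_⟩
  · apply Complex.analyticAt_of_differentiable_on_punctured_nhds_of_continuousAt
    · filter_upwards [hd, self_mem_nhdsWithin] with z hz hzx
      exact hz.congr_of_eventuallyEq (hcongr z hzx)
    · exact continuousAt_update_same.2 hlim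
  · filter_upwards [self_mem_nhdsWithin] with z hz
    exact (Function.update_of_ne hz _ _).symm

lemma exists_sub_isBigO_id {u : ℂ → ℂ}
    (hd : ∀ᶠ z in 𝓝[≠] (0 : ℂ), DifferentiableAt ℂ u z)
    (hb : u =O[𝓝[≠] 0] (fun _ => (1 : ℂ))) :
    ∃ a, (fun z => u z - a) =O[𝓝[≠] 0] (fun z : ℂ => z) := by
  obtain ⟨v, hv, huv⟩ := exists_analyticAt_of_isBigO_one hd hb
  refine ⟨v 0, ?_⟩
  have := (hv.differentiableAt.isBigO_sub).mono (nhdsWithin_le_nhds (s := {0}ᶜ))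
  refine (this.congr' ?_ ?_)
  · filter_upwards [huv] with z hz using by rw [hz]
  · exact .of_forall fun z => by simp

lemma isBigO_one_of_mul {u : ℂ → ℂ} {d : ℕ}
    (hu : (fun z => z ^ (d + 1) * u z) =O[𝓝[≠] 0] (fun z : ℂ => z)) :
    (fun z => z ^ d * u z) =O[𝓝[≠] 0] (fun _ => (1 : ℂ)) := by
  have := hu.mul (isBigO_refl (fun z : ℂ => z⁻¹) (𝓝[≠] 0))
  refine this.congr' ?_ ?_ <;>
  · filter_upwards [self_mem_nhdsWithin] with z hz
    have hz : z ≠ 0 := hz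
    field_simp
    try ring

lemma isBigO_id_one : (fun z : ℂ => z) =O[𝓝[≠] 0] (fun _ => (1 : ℂ)) :=
  (isBigO_one_iff ℂ).2 <| by
    have : Tendsto (fun z : ℂ => ‖z‖) (𝓝[≠] 0) (𝓝 0) :=
      (tendsto_norm_zero).mono_left nhdsWithin_le_nhds
    exact this.isBoundedUnder_le

lemma tendsto_neg_nhdsNE_zero : Tendsto (fun z : ℂ => -z) (𝓝[≠] 0) (𝓝[≠] 0) := by
  refine tendsto_nhdsWithin_iff.2 ⟨?_, ?_⟩
  · exact (by simpa using (continuous_neg (G := ℂ)).tendsto 0 :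
      Tendsto (fun z : ℂ => -z) (𝓝 0) (𝓝 0)).mono_left nhdsWithin_le_nhds
  · filter_upwards [self_mem_nhdsWithin] with z hz using by simpa using hz

end Removable

/-! ### Elliptic functions and Liouville-type theorems. -/

/-- Functions which are holomorphic off the lattice and periodic with respect to it. -/
structure IsElliptic (L : PeriodPair) (f : ℂ → ℂ) : Prop where
  differentiableOn : DifferentiableOn ℂ f (L.lattice : Set ℂ)ᶜ
  periodic : ∀ l ∈ L.lattice, Function.Periodic f l

/-- `f` has at the origin at most a pole of order `d`. -/
def PoleLE (d : ℕ) (f : ℂ → ℂ) : Prop :=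
  (fun z => z ^ d * f z) =O[𝓝[≠] 0] (fun _ => (1 : ℂ))

section Elliptic

variable {L : PeriodPair} {f g : ℂ → ℂ}

lemma periodic_of_periods (h₁ : Function.Periodic f L.ω₁) (h₂ : Function.Periodic f L.ω₂) :
    ∀ l ∈ L.lattice, Function.Periodic f l := by
  intro l hl
  obtain ⟨m, n, rfl⟩ := PeriodPair.mem_lattice.1 hl
  exact (h₁.int_mul m).add_period (h₂.int_mul n)

namespace IsElliptic

lemma const (a : ℂ) : IsElliptic L (fun _ => a) := ⟨by fun_prop, fun _ _ _ => rfl⟩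

lemma add (hf : IsElliptic L f) (hg : IsElliptic L g) : IsElliptic L (fun z => f z + g z) :=
  ⟨hf.1.add hg.1, fun l hl z => by simp only [hf.2 l hl z, hg.2 l hl z]⟩

lemma sub (hf : IsElliptic L f) (hg : IsElliptic L g) : IsElliptic L (fun z => f z - g z) :=
  ⟨hf.1.sub hg.1, fun l hl z => by simp only [hf.2 l hl z, hg.2 l hl z]⟩

lemma mul (hf : IsElliptic L f) (hg : IsElliptic L g) : IsElliptic L (fun z => f z * g z) :=
  ⟨hf.1.mul hg.1, fun l hl z => by simp only [hf.2 l hl z, hg.2 l hl z]⟩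

lemma const_mul (a : ℂ) (hf : IsElliptic L f) : IsElliptic L (fun z => a * f z) :=
  (IsElliptic.const a).mul hf

lemma comp_neg (hf : IsElliptic L f) : IsElliptic L (fun z => f (-z)) :=
  ⟨hf.1.comp (by fun_prop) fun z hz => by simpa using hz, fun l hl z => by
    simpa [add_comm] using hf.2 (-l) (neg_mem hl) (-z)⟩

lemma differentiableAt (hf : IsElliptic L f) {z : ℂ} (hz : z ∉ L.lattice) :
    DifferentiableAt ℂ f z :=
  hf.1.differentiableAt (L.isClosed_lattice.isOpen_compl.mem_nhds hz)

end IsElliptic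

lemma eventually_notMem_lattice (L : PeriodPair) : ∀ᶠ z in 𝓝[≠] (0 : ℂ), z ∉ L.lattice := by
  filter_upwards [mem_nhdsWithin_of_mem_nhds (L.compl_lattice_sdiff_singleton_mem_nhds 0),
    self_mem_nhdsWithin] with z hz hz0 hzL
  exact hz ⟨hzL, hz0⟩

/-- Liouville's theorem for elliptic functions. -/
lemma IsElliptic.exists_eq_const (hf : IsElliptic L f) (hb : PoleLE 0 f) :
    ∃ a, ∀ z, z ∉ L.lattice → f z = a := by
  classical
  obtain ⟨v, hv, hfv⟩ := exists_analyticAt_of_isBigO_one (u := f) (x := 0)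
    ((eventually_notMem_lattice L).mono fun z hz => hf.differentiableAt hz)
    (by simpa [PoleLE] using hb)
  -- The values of `f` on the lattice are arbitrary, so they are replaced by the limit at `0`.
  let F : ℂ → ℂ := fun z => if z ∈ L.lattice then v 0 else f z
  have hper : ∀ z w : ℂ, w ∈ L.lattice → F (z + w) = F z := fun z w hw => by
    simp only [F, hf.2 w hw z, L.lattice.add_mem_iff_left hw]
  have h0 : DifferentiableAt ℂ F 0 := by
    refine hv.differentiableAt.congr_of_eventuallyEq ?_
    refine eventuallyEq_nhds_of_eventuallyEq_nhdsNE ?_ (by simp [F])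
    filter_upwards [hfv, eventually_notMem_lattice L] with z hz hzL
    simp [F, hzL, hz]
  have hF : Differentiable ℂ F := by
    intro z
    by_cases hz : z ∈ L.lattice
    · have h1 : F = fun w => F (w - z) := by
        ext w
        rw [← hper (w - z) z hz, sub_add_cancel]
      rw [h1]
      have : DifferentiableAt ℂ F (z - z) := by simpa using h0
      exact DifferentiableAt.comp (g := F) (f := fun w => w - z) z this (by fun_prop)
    · refine (hf.differentiableAt hz).congr_of_eventuallyEq ?_
      filter_upwards [L.isClosed_lattice.isOpen_compl.mem_nhds hz] with w hw
      exact if_neg hw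
  refine ⟨v 0, fun z hz => ?_⟩
  have := hF.apply_eq_apply_of_bounded
    (IsZLattice.isCompact_range_of_periodic L.lattice F hF.continuous hper).isBounded z 0
  simpa [F, hz] using this

/-- The period pair with the second period halved; its lattice is generated by `ω₁` and `ω₂ / 2`. -/
def halfPeriod (L : PeriodPair) : PeriodPair where
  ω₁ := L.ω₁
  ω₂ := L.ω₂ / 2
  indep := by
    have := L.indep
    rw [LinearIndependent.pair_iff] at this ⊢
    intro s t h
    have := this s (t / 2) (by
      rw [← h]; simp only [Complex.real_smul]; push_cast; ring)
    exact ⟨this.1, by linarith [this.2]⟩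

lemma mem_halfPeriod_of_mem {z : ℂ} (hz : z ∈ L.lattice) : z ∈ (halfPeriod L).lattice := by
  obtain ⟨m, n, rfl⟩ := PeriodPair.mem_lattice.1 hz
  refine PeriodPair.mem_lattice.2 ⟨m, 2 * n, ?_⟩
  simp only [halfPeriod]; push_cast; ring

/-- The complement of a countable set in the plane is connected, so the identity theorem applies. -/
lemma IsElliptic.eq_zero_of_eventuallyEq_zero (hf : IsElliptic L f) {x : ℂ} (hx : x ∉ L.lattice)
    (h : f =ᶠ[𝓝 x] 0) : ∀ z, z ∉ L.lattice → f z = 0 := by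
  have hc : (L.lattice : Set ℂ).Countable :=
    Set.countable_coe_iff.1 (L.latticeEquivProd.toEquiv.countable_iff.2 inferInstance)
  have hconn : IsPreconnected ((L.lattice : Set ℂ)ᶜ) :=
    (hc.isPathConnected_compl_of_one_lt_rank (by
      rw [Complex.rank_real_complex]; norm_num)).isConnected.isPreconnected
  exact fun z hz => (hf.1.analyticOnNhd
    L.isClosed_lattice.isOpen_compl).eqOn_zero_of_preconnected_of_eventuallyEq_zero hconn hx h hz

/-- An odd elliptic function with at most a simple pole vanishes. -/
lemma IsElliptic.eq_zero_of_odd (hf : IsElliptic L f) (hodd : ∀ z, f (-z) = -f z)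
    (hp : PoleLE 1 f) : ∀ z, z ∉ L.lattice → f z = 0 := by
  -- Half-periods are fixed by `z ↦ -z` modulo the lattice, so oddness forces zeros there.
  have hhalf : ∀ l ∈ L.lattice, f (l / 2) = 0 := fun l hl => by
    have h1 := hf.2 l hl (-(l / 2))
    rw [hodd, show -(l / 2) + l = l / 2 by ring] at h1
    exact CharZero.eq_neg_self_iff.1 h1
  set q := L.ω₂ / 2 with hq
  have hqL : q ∉ L.lattice := L.ω₂_div_two_notMem_lattice
  -- Translation by `q` swaps the two factors up to a period, so the product has the finer lattice.
  -- The zero of `f` at `q` cancels the simple pole at `0`; Liouville then replaces the residue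
  -- theorem.
  have hF : IsElliptic (halfPeriod L) (fun z => f z * f (z + q)) := by
    constructor
    · intro z hz
      have h1 : z ∉ L.lattice := fun h => hz (mem_halfPeriod_of_mem h)
      have h2 : z + q ∉ L.lattice := fun h => hz (by
        have := sub_mem (mem_halfPeriod_of_mem h) (halfPeriod L).ω₂_mem_lattice
        simpa [halfPeriod, q] using this)
      have h3 : DifferentiableAt ℂ (fun z => f (z + q)) z :=
        DifferentiableAt.comp z (hf.differentiableAt h2) (by fun_prop)
      exact ((hf.differentiableAt h1).fun_mul h3).differentiableWithinAt
    · refine periodic_of_periods (fun z => ?_) (fun z => ?_)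
      · have h1 := hf.2 _ L.ω₁_mem_lattice
        have := h1 (z + q)
        simp only [halfPeriod, h1 z, show z + L.ω₁ + q = z + q + L.ω₁ by ring, this]
      · have := hf.2 _ L.ω₂_mem_lattice z
        simp only [halfPeriod, ← hq, show z + q + q = z + L.ω₂ by simp only [hq]; ring, this]
        ring
  have hFb : PoleLE 0 (fun z => f z * f (z + q)) := by
    have h1 : (fun z => f (z + q)) =O[𝓝[≠] 0] (fun z : ℂ => z) := by
      have hd : DifferentiableAt ℂ (fun z => f (z + q)) 0 :=
        DifferentiableAt.comp (0 : ℂ) (by simpa using hf.differentiableAt hqL) (by fun_prop)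
      have := hd.isBigO_sub.mono (nhdsWithin_le_nhds (s := {0}ᶜ))
      simpa [hhalf _ L.ω₂_mem_lattice, q] using this
    have h2 := (hp.mul h1).mul (isBigO_refl (fun z : ℂ => z⁻¹) (𝓝[≠] 0))
    refine h2.congr' ?_ ?_ <;>
    · filter_upwards [self_mem_nhdsWithin] with z hz
      have hz : z ≠ 0 := hz
      field_simp
  obtain ⟨a, ha⟩ := hF.exists_eq_const hFb
  have ha0 : a = 0 := by
    rw [← ha (L.ω₁ / 2) (halfPeriod L).ω₁_div_two_notMem_lattice, hhalf _ L.ω₁_mem_lattice,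
      zero_mul]
  by_contra! hne
  obtain ⟨x, hx, hfx⟩ := hne
  have hx' : x ∉ (halfPeriod L).lattice := fun hmem => hfx (by
    obtain ⟨m, n, rfl⟩ := PeriodPair.mem_lattice.1 hmem
    have h2 : (((2 * m : ℤ) : ℂ) * L.ω₁ + n * L.ω₂) ∈ L.lattice :=
      PeriodPair.mem_lattice.2 ⟨_, _, rfl⟩
    rw [← hhalf _ h2]
    congr 1
    simp only [halfPeriod]; push_cast; ring)
  have hxq : x + q ∉ L.lattice := fun hmem => hx' (by
    simpa [halfPeriod, q] using sub_mem (mem_halfPeriod_of_mem hmem) (halfPeriod L).ω₂_mem_lattice)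
  have hnear : ∀ᶠ z in 𝓝 x, f (z + q) = 0 := by
    filter_upwards [(hf.differentiableAt hx).continuousAt.eventually_ne hfx,
      (halfPeriod L).isClosed_lattice.isOpen_compl.mem_nhds hx'] with z hz hzL
    have := ha z hzL
    rw [ha0] at this
    exact (mul_eq_zero.1 this).resolve_left hz
  refine hfx (hf.eq_zero_of_eventuallyEq_zero hxq ?_ x hx)
  have hsub : Tendsto (fun w => w - q) (𝓝 (x + q)) (𝓝 x) := by
    have : ContinuousAt (fun w => w - q) (x + q) := by fun_prop
    simpa [ContinuousAt] using this
  filter_upwards [hsub.eventually hnear] with w hw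
  simpa using hw

/-- There is no elliptic function with exactly one simple pole. -/
lemma IsElliptic.poleLE_zero (hf : IsElliptic L f) (hp : PoleLE 1 f) : PoleLE 0 f := by
  have hdiff : ∀ᶠ z in 𝓝[≠] (0 : ℂ), DifferentiableAt ℂ (fun z => z ^ 1 * f z) z :=
    (eventually_notMem_lattice L).mono fun z hz =>
      (differentiableAt_id.pow 1).fun_mul (hf.differentiableAt hz)
  obtain ⟨a, ha⟩ := exists_sub_isBigO_id hdiff hp
  have ha' := ha.comp_tendsto tendsto_neg_nhdsNE_zero
  -- The principal part `a/z` contributes `2a/z` to the odd function `f(z) - f(-z)`, whose vanishing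
  -- forces `a = 0`.
  have hg := (hf.sub hf.comp_neg).eq_zero_of_odd (by simp) (by
    have := hp.add (hp.comp_tendsto tendsto_neg_nhdsNE_zero)
    refine this.congr_left fun z => ?_
    simp only [Function.comp]; ring)
  have h2a : (fun _ : ℂ => 2 * a) =O[𝓝[≠] 0] (fun z : ℂ => z) := by
    have h1 : (fun z : ℂ => -z) =O[𝓝[≠] 0] (fun z : ℂ => z) := (isBigO_refl _ _).neg_left
    refine ((ha.add (ha'.trans h1)).neg_left).congr' ?_ .rfl
    filter_upwards [eventually_notMem_lattice L] with z hz
    have := hg z hz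
    simp only [Function.comp]
    linear_combination -z * this
  have ha0 : a = 0 := by
    have h0 : Tendsto (fun z : ℂ => z) (𝓝[≠] 0) (𝓝 0) := tendsto_id.mono_left nhdsWithin_le_nhds
    have := tendsto_nhds_unique (h2a.trans_tendsto h0) tendsto_const_nhds
    simpa using this.symm
  refine isBigO_one_of_mul ?_
  simpa [ha0] using ha

end Elliptic

/-! ### Arithmetic of pole orders. -/

section PoleOrder

variable {f g : ℂ → ℂ} {d e : ℕ}

lemma PoleLE.mono (hf : PoleLE d f) (hde : d ≤ e) : PoleLE e f := by
  obtain ⟨k, rfl⟩ := Nat.exists_eq_add_of_le hde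
  have := (isBigO_id_one.pow k).mul hf
  refine this.congr (fun z => ?_) (fun z => by simp)
  ring

lemma PoleLE.add (hf : PoleLE d f) (hg : PoleLE d g) : PoleLE d (fun z => f z + g z) :=
  (IsBigO.add hf hg).congr_left fun z => by ring

lemma PoleLE.const_mul (hf : PoleLE d f) (a : ℂ) : PoleLE d (fun z => a * f z) :=
  (IsBigO.const_mul_left hf a).congr_left fun z => by ring

lemma PoleLE.comp_neg (hf : PoleLE d f) : PoleLE d (fun z => f (-z)) := by
  have := (IsBigO.comp_tendsto hf tendsto_neg_nhdsNE_zero).const_mul_left ((-1) ^ d)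
  refine this.congr_left fun z => ?_
  simp only [Function.comp]
  rw [← mul_assoc, ← mul_pow]
  simp

lemma IsMonicOfDegree.poleLE (hf : IsMonicOfDegree d f) : PoleLE d f := by
  have := (IsBigO.trans hf isBigO_id_one).add (isBigO_refl (fun _ : ℂ => (1 : ℂ)) _)
  exact this.congr_left fun z => by ring

end PoleOrder

/-! ### The bilinear form on `γ` and its reflection symmetry. -/

section Integral

variable {τ : UpperHalfPlane} {f g : ℂ → ℂ}

lemma path_notMem_lattice (τ : UpperHalfPlane) (t : ℝ) :
    (τ : ℂ) / 2 + t ∉ (periods τ).lattice := by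
  intro hmem
  obtain ⟨m, n, hmn⟩ := PeriodPair.mem_lattice.1 hmem
  have him := congrArg Complex.im hmn
  simp [periods] at him
  have h2 : (n : ℝ) * 2 = 1 := by
    have := τ.im_ne_zero
    field_simp at him
    linarith
  norm_cast at h2
  omega

lemma IsElliptic.continuous_path (hf : IsElliptic (periods τ) f) :
    Continuous (fun t : ℝ => f ((τ : ℂ) / 2 + t)) :=
  hf.1.continuousOn.comp_continuous (by fun_prop) (path_notMem_lattice τ)

lemma gammaIntegral_congr (hfg : ∀ z, z ∉ (periods τ).lattice → f z = g z) :
    gammaIntegral τ f = gammaIntegral τ g := by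
  unfold gammaIntegral
  simp only [fun t : ℝ => hfg _ (path_notMem_lattice τ t)]

lemma gammaIntegral_sub (hf : IsElliptic (periods τ) f) (hg : IsElliptic (periods τ) g) :
    gammaIntegral τ (fun z => f z - g z) = gammaIntegral τ f - gammaIntegral τ g :=
  intervalIntegral.integral_sub (hf.continuous_path.intervalIntegrable _ _)
    (hg.continuous_path.intervalIntegrable _ _)

lemma gammaIntegral_const_mul (a : ℂ) (f : ℂ → ℂ) :
    gammaIntegral τ (fun z => a * f z) = a * gammaIntegral τ f :=
  intervalIntegral.integral_const_mul _ _

/-- The map `z ↦ 1 + τ - z` sends `γ` to itself, and `1 + τ` is a period. -/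
lemma IsElliptic.gammaIntegral_comp_neg (hf : IsElliptic (periods τ) f) :
    gammaIntegral τ (fun z => f (-z)) = gammaIntegral τ f := by
  have h1 : ∀ t : ℝ, f (-((τ : ℂ) / 2 + t)) = f ((τ : ℂ) / 2 + (1 - t : ℝ)) := fun t => by
    have := hf.2 (1 + τ) (add_mem (periods τ).ω₁_mem_lattice (periods τ).ω₂_mem_lattice)
      (-((τ : ℂ) / 2 + t))
    rw [← this]
    congr 1
    push_cast; ring
  unfold gammaIntegral
  simp only [h1]
  rw [intervalIntegral.integral_comp_sub_left (fun t : ℝ => f ((τ : ℂ) / 2 + t))]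
  simp

/-- The bilinear form `∫_γ f g`. -/
def innerInt (τ : UpperHalfPlane) (f g : ℂ → ℂ) : ℂ := gammaIntegral τ (fun z => f z * g z)

lemma innerInt_comm (f g : ℂ → ℂ) : innerInt τ f g = innerInt τ g f := by
  simp only [innerInt, mul_comm]

lemma innerInt_mul_left (f g k : ℂ → ℂ) :
    innerInt τ (fun z => k z * f z) g = innerInt τ (fun z => k z * g z) f := by
  unfold innerInt; congr 1; ext z; ring

lemma innerInt_congr_left {k : ℂ → ℂ} (hfg : ∀ z, z ∉ (periods τ).lattice → f z = g z) :
    innerInt τ f k = innerInt τ g k :=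
  gammaIntegral_congr fun z hz => by rw [hfg z hz]

lemma innerInt_sub_left {k : ℂ → ℂ} (hf : IsElliptic (periods τ) f)
    (hg : IsElliptic (periods τ) g) (hk : IsElliptic (periods τ) k) :
    innerInt τ (fun z => f z - g z) k = innerInt τ f k - innerInt τ g k := by
  simp only [innerInt, sub_mul]
  exact gammaIntegral_sub (hf.mul hk) (hg.mul hk)

lemma innerInt_const_mul_left (a : ℂ) (f g : ℂ → ℂ) :
    innerInt τ (fun z => a * f z) g = a * innerInt τ f g := by
  simp only [innerInt, mul_assoc, gammaIntegral_const_mul]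

lemma innerInt_add_left {k : ℂ → ℂ} (hf : IsElliptic (periods τ) f)
    (hg : IsElliptic (periods τ) g) (hk : IsElliptic (periods τ) k) :
    innerInt τ (fun z => f z + g z) k = innerInt τ f k + innerInt τ g k := by
  have := innerInt_sub_left hf (hg.const_mul (-1)) hk
  rw [innerInt_const_mul_left] at this
  simpa using this

/-- Elliptic functions of opposite parity are orthogonal. -/
lemma innerInt_eq_zero_of_parity (hf : IsElliptic (periods τ) f) (hg : IsElliptic (periods τ) g)
    {a b : ℂ} (hab : a * b = -1) (hfa : ∀ z, z ∉ (periods τ).lattice → f (-z) = a * f z)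
    (hgb : ∀ z, z ∉ (periods τ).lattice → g (-z) = b * g z) : innerInt τ f g = 0 := by
  have h1 := (hf.mul hg).gammaIntegral_comp_neg
  have h2 : gammaIntegral τ (fun z => f (-z) * g (-z)) = -innerInt τ f g := by
    rw [gammaIntegral_congr (g := fun z => (-1) * (f z * g z)) fun z hz => by
      rw [hfa z hz, hgb z hz, ← hab]; ring, gammaIntegral_const_mul]
    simp [innerInt]
  rw [h2] at h1
  exact CharZero.eq_neg_self_iff.1 h1.symm

end Integral

/-! ### Orthogonality, uniqueness and parity. -/

section Orthogonality

variable {τ : UpperHalfPlane} {π : ℕ → ℂ → ℂ} {f : ℂ → ℂ}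

lemma IsEOP.isElliptic (hπ : IsEOP τ π) {n : ℕ} (hn : n ≠ 1) : IsElliptic (periods τ) (π n) :=
  ⟨(hπ.isEllipticPolynomial n hn).differentiableOn,
    periodic_of_periods (hπ.isEllipticPolynomial n hn).periodic_one
      (hπ.isEllipticPolynomial n hn).periodic_tau⟩

lemma h_eq_innerInt (n : ℕ) : h τ π n = innerInt τ (π n) (π n) := by
  simp only [h, innerInt, sq]

lemma IsEOP.innerInt_eq_zero (hπ : IsEOP τ π) {m n : ℕ} (hm : m ≠ 1) (hn : n ≠ 1) (hmn : m ≠ n) :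
    innerInt τ (π m) (π n) = 0 :=
  hπ.orthogonal m n hm hn hmn

lemma IsEOP.zero_eq_one (hπ : IsEOP τ π) {z : ℂ} (hz : z ∉ (periods τ).lattice) : π 0 z = 1 := by
  have hm := hπ.monic 0 (by norm_num)
  obtain ⟨a, ha⟩ := (hπ.isElliptic (n := 0) (by norm_num)).exists_eq_const hm.poleLE
  have h0 : Tendsto (fun z : ℂ => z) (𝓝[≠] 0) (𝓝 0) := tendsto_id.mono_left nhdsWithin_le_nhds
  have h1 := IsBigO.trans_tendsto hm h0
  have h2 : Tendsto (fun z : ℂ => z ^ 0 * π 0 z - 1) (𝓝[≠] 0) (𝓝 (a - 1)) := by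
    refine tendsto_const_nhds.congr' ?_
    filter_upwards [eventually_notMem_lattice (periods τ)] with w hw
    rw [ha w hw]; ring
  rw [ha z hz]
  linear_combination tendsto_nhds_unique h2 h1

/-- The leading term of a pole can be removed by subtracting a multiple of a monic function. -/
lemma IsElliptic.exists_sub_poleLE {L : PeriodPair} {p : ℂ → ℂ} {d : ℕ} (hf : IsElliptic L f)
    (hd : PoleLE (d + 1) f) (hp : IsMonicOfDegree (d + 1) p) :
    ∃ a, PoleLE d (fun z => f z - a * p z) := by
  have hdiff : ∀ᶠ z in 𝓝[≠] (0 : ℂ), DifferentiableAt ℂ (fun z => z ^ (d + 1) * f z) z :=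
    (eventually_notMem_lattice L).mono fun z hz =>
      (differentiableAt_id.pow _).fun_mul (hf.differentiableAt hz)
  obtain ⟨a, ha⟩ := exists_sub_isBigO_id hdiff hd
  refine ⟨a, isBigO_one_of_mul ?_⟩
  exact (IsBigO.sub ha (IsBigO.const_mul_left hp a)).congr_left fun z => by ring

/-- `π_n` is orthogonal to all elliptic polynomials of lower degree. -/
lemma IsEOP.innerInt_eq_zero_of_poleLE (hπ : IsEOP τ π) {d n : ℕ} (hf : IsElliptic (periods τ) f)
    (hd : PoleLE d f) (hdn : d < n) (hn : n ≠ 1) : innerInt τ f (π n) = 0 := by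
  have hzero : ∀ {f : ℂ → ℂ}, IsElliptic (periods τ) f → PoleLE 0 f →
      innerInt τ f (π n) = 0 := fun {f} hf hd => by
    obtain ⟨a, ha⟩ := hf.exists_eq_const hd
    rw [innerInt_congr_left (g := fun z => a * π 0 z) fun z hz => by
      rw [ha z hz, hπ.zero_eq_one hz, mul_one], innerInt_const_mul_left,
      hπ.innerInt_eq_zero (by norm_num) hn (by omega), mul_zero]
  induction d generalizing f with
  | zero => exact hzero hf hd
  | succ d ih =>
    rcases Nat.eq_zero_or_pos d with rfl | hpos
    -- Degree one needs no `π_1`: a lone simple pole is impossible, so `f` is constant off the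
    -- lattice.
    · exact hzero hf (hf.poleLE_zero hd)
    · have hd1 : d + 1 ≠ 1 := by omega
      obtain ⟨a, ha⟩ := hf.exists_sub_poleLE hd (hπ.monic (d + 1) hd1)
      have hE := (hπ.isElliptic hd1).const_mul a
      have := ih (hf.sub hE) ha (by omega)
      rwa [innerInt_sub_left hf hE (hπ.isElliptic hn), innerInt_const_mul_left,
        hπ.innerInt_eq_zero hd1 hn (by omega), mul_zero, sub_zero] at this

/-- An elliptic polynomial of degree at most `d` orthogonal to `π_0, …, π_d` vanishes. -/
lemma IsEOP.eq_zero_of_innerInt_eq_zero (hπ : IsEOP τ π)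
    (hnorm : ∀ n, n ≠ 1 → h τ π n ≠ 0) {d : ℕ} (hf : IsElliptic (periods τ) f)
    (hd : PoleLE d f) (hort : ∀ m ≤ d, m ≠ 1 → innerInt τ f (π m) = 0) :
    ∀ z, z ∉ (periods τ).lattice → f z = 0 := by
  have hzero : ∀ {f : ℂ → ℂ}, IsElliptic (periods τ) f → PoleLE 0 f →
      innerInt τ f (π 0) = 0 → ∀ z, z ∉ (periods τ).lattice → f z = 0 := fun {f} hf hd h0 => by
    obtain ⟨a, ha⟩ := hf.exists_eq_const hd
    rw [innerInt_congr_left (g := fun z => a * π 0 z) fun z hz => by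
      rw [ha z hz, hπ.zero_eq_one hz, mul_one], innerInt_const_mul_left, ← h_eq_innerInt] at h0
    have := (mul_eq_zero.1 h0).resolve_right (hnorm 0 (by norm_num))
    simpa [this] using ha
  induction d with
  | zero => exact hzero hf hd (hort 0 le_rfl (by norm_num))
  | succ d ih =>
    rcases Nat.eq_zero_or_pos d with rfl | hpos
    · exact hzero hf (hf.poleLE_zero hd) (hort 0 (by omega) (by norm_num))
    · have hd1 : d + 1 ≠ 1 := by omega
      obtain ⟨a, ha⟩ := hf.exists_sub_poleLE hd (hπ.monic (d + 1) hd1)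
      have hE := (hπ.isElliptic hd1).const_mul a
      -- Pairing with `π_{d+1}` isolates `a h_{d+1}`; the condition `h_{d+1} ≠ 0` does the work of
      -- positivity, which this complex bilinear form lacks.
      have h1 := hπ.innerInt_eq_zero_of_poleLE (hf.sub hE) ha (Nat.lt_succ_self d) hd1
      rw [innerInt_sub_left hf hE (hπ.isElliptic hd1), innerInt_const_mul_left,
        hort _ le_rfl hd1, ← h_eq_innerInt, zero_sub, neg_eq_zero] at h1
      have ha0 := (mul_eq_zero.1 h1).resolve_right (hnorm _ hd1)
      simp only [ha0, zero_mul, sub_zero] at ha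
      exact ih ha fun m hm => hort m (by omega)

/-- `π_n` has the parity of `n`. -/
lemma IsEOP.comp_neg (hπ : IsEOP τ π) (hnorm : ∀ n, n ≠ 1 → h τ π n ≠ 0) {n : ℕ} (hn : n ≠ 1)
    {z : ℂ} (hz : z ∉ (periods τ).lattice) : π n (-z) = (-1) ^ n * π n z := by
  obtain _ | n := n
  · rw [hπ.zero_eq_one hz, hπ.zero_eq_one (by simpa using hz)]; simp
  have hE := hπ.isElliptic hn
  have hE' := hE.const_mul ((-1) ^ (n + 1))
  have hp : PoleLE n (fun z => π (n + 1) (-z) - (-1) ^ (n + 1) * π (n + 1) z) := by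
    have hm := hπ.monic _ hn
    have h1 : (fun z : ℂ => -z) =O[𝓝[≠] 0] (fun z : ℂ => z) := (isBigO_refl _ _).neg_left
    have h2 := (IsBigO.comp_tendsto hm tendsto_neg_nhdsNE_zero).trans h1
    refine isBigO_one_of_mul (((h2.sub hm).const_mul_left ((-1) ^ (n + 1))).congr_left fun z => ?_)
    have h3 : ((-1 : ℂ) ^ (n + 1)) ^ 2 = 1 := by rw [← pow_mul, mul_comm, pow_mul]; simp
    simp only [Function.comp]
    rw [neg_pow z]
    linear_combination (z ^ (n + 1) * π (n + 1) (-z)) * h3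
  refine sub_eq_zero.1 (hπ.eq_zero_of_innerInt_eq_zero hnorm (hE.comp_neg.sub hE') hp
    (fun m hm hm1 => ?_) z hz)
  have hEm := hπ.isElliptic hm1
  rw [innerInt_sub_left hE.comp_neg hE' hEm, innerInt_const_mul_left,
    hπ.innerInt_eq_zero hn hm1 (by omega), mul_zero, sub_zero]
  -- The reflection moves the sign onto `π_m`, which keeps its degree and stays orthogonal to
  -- `π_{n+1}`.
  have h1 := (hE.comp_neg.mul hEm).gammaIntegral_comp_neg
  simp only [neg_neg] at h1
  rw [innerInt, ← h1]
  have := hπ.innerInt_eq_zero_of_poleLE hEm.comp_neg (hπ.monic m hm1).poleLE.comp_neg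
    (by omega : m < n + 1) hn
  rwa [innerInt_comm] at this

end Orthogonality

/-! ### Expansions to second order. -/

/-- `f(z) = z⁻ᴺ (1 + a z² + O(z³))` as `z → 0`. -/
def HasExpansion (N : ℕ) (f : ℂ → ℂ) (a : ℂ) : Prop :=
  (fun z : ℂ => z ^ N * f z - 1 - a * z ^ 2) =O[𝓝[≠] 0] (fun z : ℂ => z ^ 3)

section Expansion

variable {f g : ℂ → ℂ} {N M : ℕ} {a b : ℂ}

lemma isBigO_pow_one (k : ℕ) : (fun z : ℂ => z ^ k) =O[𝓝[≠] 0] (fun _ => (1 : ℂ)) := by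
  simpa using isBigO_id_one.pow k

lemma HasExpansion.isMonicOfDegree (hf : HasExpansion N f a) : IsMonicOfDegree N f := by
  have hz : (fun z : ℂ => z) =O[𝓝[≠] 0] (fun z : ℂ => z) := isBigO_refl _ _
  have h3 : (fun z : ℂ => z ^ 3) =O[𝓝[≠] 0] (fun z : ℂ => z) :=
    ((isBigO_pow_one 2).mul hz).congr (fun z => by ring) (fun z => by ring)
  have h2 : (fun z : ℂ => a * z ^ 2) =O[𝓝[≠] 0] (fun z : ℂ => z) :=
    ((((isBigO_pow_one 1).mul hz).const_mul_left a)).congr (fun z => by ring) (fun z => by ring)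
  exact ((IsBigO.trans hf h3).add h2).congr_left fun z => by ring

/-- A factor `z⁻ᴺ(1 + O(z³))` does not change the `z²` coefficient of the other factor. -/
lemma HasExpansion.mul (hf : HasExpansion N f 0) (hg : HasExpansion M g b) :
    HasExpansion (N + M) (fun z => f z * g z) b := by
  have h1 := IsBigO.mul hf hg.isMonicOfDegree.poleLE
  have h2 := (IsBigO.congr_right h1 (g₂ := fun z : ℂ => z ^ 3) (fun z => by ring)).add hg
  exact h2.congr_left fun z => by ring

/-- From pole order three on, the holomorphic part only enters the `O(z³)` error. For the double
pole of `℘` one also needs `v 0 = 0`. -/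
lemma HasExpansion.of_analyticAt_add {v : ℂ → ℂ} (hv : AnalyticAt ℂ v 0) (k : ℕ)
    (hfv : ∀ᶠ z in 𝓝[≠] 0, f z = 1 / z ^ (k + 3) + v z) : HasExpansion (k + 3) f 0 := by
  have hv1 : v =O[𝓝[≠] 0] (fun _ => (1 : ℂ)) :=
    (hv.continuousAt.isBigO_one ℂ).mono nhdsWithin_le_nhds
  have h1 := (isBigO_refl (fun z : ℂ => z ^ 3) (𝓝[≠] 0)).mul ((isBigO_pow_one k).mul hv1)
  refine h1.congr' ?_ (.of_forall fun z => by simp)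
  filter_upwards [hfv, self_mem_nhdsWithin] with z hz hz0
  have hz0 : z ≠ 0 := hz0
  rw [hz]
  field_simp
  ring

lemma taylorCoeff_eq {v : ℂ → ℂ} (hv : AnalyticAt ℂ v 0) (hfv : f =ᶠ[𝓝[≠] 0] v) (j : ℕ) :
    taylorCoeff f j = iteratedDeriv j v 0 / (j.factorial : ℂ) := by
  have hlim : Tendsto f (𝓝[≠] 0) (𝓝 (v 0)) :=
    (hv.continuousAt.tendsto.mono_left nhdsWithin_le_nhds).congr' hfv.symm
  have : Function.update f 0 (limUnder (𝓝[≠] (0 : ℂ)) f) =ᶠ[𝓝 0] v := by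
    refine eventuallyEq_nhds_of_eventuallyEq_nhdsNE ?_ (by simp [hlim.limUnder_eq])
    filter_upwards [hfv, self_mem_nhdsWithin] with z hz hz0
    rw [Function.update_of_ne hz0, hz]
  rw [taylorCoeff, this.iteratedDeriv_eq]

lemma isBigO_sub_taylor_two {v : ℂ → ℂ} (hv : AnalyticAt ℂ v 0) :
    (fun z => v z - v 0 - deriv v 0 * z - iteratedDeriv 2 v 0 / 2 * z ^ 2) =O[𝓝 0]
      (fun z : ℂ => z ^ 3) := by
  have := hv.hasFPowerSeriesAt.isBigO_sub_partialSum_pow 3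
  refine (this.congr_left fun z => ?_).trans (IsBigO.of_bound 1 (.of_forall fun z => by simp))
  simp [FormalMultilinearSeries.partialSum, Finset.sum_range_succ]
  ring

end Expansion

/-! ### `℘` and `-℘'/2` as multipliers. -/

section Weierstrass

variable (τ : UpperHalfPlane)

/-- The function `-℘' / 2`, normalized to be `z⁻³ + O(z)`. -/
def halfDeriv (z : ℂ) : ℂ := -(periods τ).derivWeierstrassP z / 2

lemma isElliptic_wp : IsElliptic (periods τ) (wp τ) :=
  ⟨(periods τ).differentiableOn_weierstrassP, fun l hl => (periods τ).periodic_weierstrassP ⟨l, hl⟩⟩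

lemma isElliptic_halfDeriv : IsElliptic (periods τ) (halfDeriv τ) :=
  ⟨((periods τ).differentiableOn_derivWeierstrassP.neg).div_const 2, fun l hl z => by
    simp only [halfDeriv, (periods τ).periodic_derivWeierstrassP ⟨l, hl⟩ z]⟩

lemma halfDeriv_sq {z : ℂ} (hz : z ∉ (periods τ).lattice) :
    halfDeriv τ z ^ 2 =
      wp τ z ^ 3 - (periods τ).g₂ / 4 * wp τ z - (periods τ).g₃ / 4 := by
  have := (periods τ).derivWeierstrassP_sq z hz
  simp only [halfDeriv, wp]
  linear_combination this / 4

lemma wp_neg (z : ℂ) : wp τ (-z) = wp τ z := (periods τ).weierstrassP_neg z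

lemma halfDeriv_neg (z : ℂ) : halfDeriv τ (-z) = -halfDeriv τ z := by
  simp only [halfDeriv, (periods τ).derivWeierstrassP_neg z]; ring

lemma wp_eq (z : ℂ) : wp τ z = 1 / z ^ 2 + (periods τ).weierstrassPExcept 0 z := by
  have := (periods τ).weierstrassPExcept_add 0 z
  simp only [ZeroMemClass.coe_zero, sub_zero] at this
  simp only [wp, ← this]
  simp; ring

lemma hasExpansion_wp : HasExpansion 2 (wp τ) 0 := by
  have hv := (periods τ).analyticAt_weierstrassPExcept 0
  have h1 : (periods τ).weierstrassPExcept 0 =O[𝓝[≠] 0] (fun z : ℂ => z) := by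
    simpa using hv.differentiableAt.isBigO_sub.mono (nhdsWithin_le_nhds (s := {0}ᶜ))
  have h2 := (isBigO_refl (fun z : ℂ => z ^ 2) (𝓝[≠] 0)).mul h1
  refine h2.congr' ?_ (.of_forall fun z => by ring)
  filter_upwards [self_mem_nhdsWithin] with z hz
  have hz : z ≠ 0 := hz
  rw [wp_eq]
  field_simp
  ring

lemma hasExpansion_halfDeriv : HasExpansion 3 (halfDeriv τ) 0 := by
  have hv := (periods τ).analyticAt_derivWeierstrassPExcept 0
  refine HasExpansion.of_analyticAt_add (k := 0)
    (v := fun z => -(periods τ).derivWeierstrassPExcept 0 z / 2) (hv.neg.div_const) ?_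
  refine .of_forall fun z => ?_
  have := (periods τ).derivWeierstrassPExcept_def 0 z
  simp only [ZeroMemClass.coe_zero, sub_zero] at this
  simp only [halfDeriv, this]
  ring

end Weierstrass

/-! ### Pairings computed from expansions. -/

section Coefficients

variable {τ : UpperHalfPlane} {π : ℕ → ℂ → ℂ} {f : ℂ → ℂ}

lemma IsEOP.hasExpansion (hπ : IsEOP τ π) (hnorm : ∀ n, n ≠ 1 → h τ π n ≠ 0) {n : ℕ}
    (hn : n ≠ 1) : HasExpansion n (π n) (c π 2 n) := by
  have hE := hπ.isElliptic hn
  have hm := hπ.monic n hn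
  have hdiff : ∀ᶠ z in 𝓝[≠] (0 : ℂ), DifferentiableAt ℂ (fun z => z ^ n * π n z) z :=
    (eventually_notMem_lattice (periods τ)).mono fun z hz =>
      (differentiableAt_id.pow _).fun_mul (hE.differentiableAt hz)
  obtain ⟨v, hv, huv⟩ := exists_analyticAt_of_isBigO_one hdiff hm.poleLE
  have hc : c π 2 n = iteratedDeriv 2 v 0 / 2 := by
    rw [c, taylorCoeff_eq hv huv]; simp
  have hv0 : v 0 = 1 := by
    have h0 : Tendsto (fun z : ℂ => z) (𝓝[≠] 0) (𝓝 0) := tendsto_id.mono_left nhdsWithin_le_nhds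
    have h1 := IsBigO.trans_tendsto hm h0
    have h2 : Tendsto (fun z => v z - 1) (𝓝[≠] 0) (𝓝 (v 0 - 1)) :=
      (hv.continuousAt.tendsto.mono_left nhdsWithin_le_nhds).sub tendsto_const_nhds
    have h3 : Tendsto (fun z => v z - 1) (𝓝[≠] 0) (𝓝 0) :=
      h1.congr' (by filter_upwards [huv] with z hz using by rw [hz])
    linear_combination tendsto_nhds_unique h2 h3
  -- By parity `zⁿ π_n(z)` is even, so its linear coefficient vanishes.
  have hv1 : deriv v 0 = 0 := by
    have heven : (fun z => v (-z)) =ᶠ[𝓝 0] v := by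
      refine eventuallyEq_nhds_of_eventuallyEq_nhdsNE ?_ (by simp)
      filter_upwards [huv, tendsto_neg_nhdsNE_zero.eventually huv,
        eventually_notMem_lattice (periods τ)] with z h1 h2 h3
      rw [← h1, ← h2, hπ.comp_neg hnorm hn h3, ← mul_assoc, ← mul_pow]
      simp
    have := heven.deriv_eq
    rw [deriv_comp_neg, neg_zero] at this
    exact CharZero.eq_neg_self_iff.1 this.symm
  have := (isBigO_sub_taylor_two hv).mono (nhdsWithin_le_nhds (s := {0}ᶜ))
  refine this.congr' ?_ .rfl
  filter_upwards [huv] with z hz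
  rw [hz, hv0, hv1, hc]; ring

lemma IsEOP.innerInt_of_isMonicOfDegree (hπ : IsEOP τ π) {N : ℕ} (hN : 2 ≤ N)
    (hf : IsElliptic (periods τ) f) (hm : IsMonicOfDegree N f) :
    innerInt τ f (π N) = h τ π N := by
  obtain ⟨d, rfl⟩ : ∃ d, N = d + 1 := ⟨N - 1, by omega⟩
  have hN1 : d + 1 ≠ 1 := by omega
  have hp : PoleLE d (fun z => f z - π (d + 1) z) :=
    isBigO_one_of_mul ((IsBigO.sub hm (hπ.monic _ hN1)).congr_left fun z => by ring)
  have := hπ.innerInt_eq_zero_of_poleLE (hf.sub (hπ.isElliptic hN1)) hp (Nat.lt_succ_self d) hN1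
  rw [innerInt_sub_left hf (hπ.isElliptic hN1) (hπ.isElliptic hN1), ← h_eq_innerInt] at this
  exact sub_eq_zero.1 this

/-- Neither `f` nor `π_{m+2}` has a `z^(-m-1)` term, so subtracting `π_{m+2}` and `(a - c_{2,m+2})
π_m` leaves degree less than `m`, orthogonal to `π_m`. -/
lemma IsEOP.innerInt_of_hasExpansion (hπ : IsEOP τ π) (hnorm : ∀ n, n ≠ 1 → h τ π n ≠ 0)
    {m : ℕ} (hm : 2 ≤ m) {a : ℂ} (hf : IsElliptic (periods τ) f) (ha : HasExpansion (m + 2) f a) :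
    innerInt τ f (π m) = (a - c π 2 (m + 2)) * h τ π m := by
  obtain ⟨d, rfl⟩ : ∃ d, m = d + 1 := ⟨m - 1, by omega⟩
  have hm1 : d + 1 ≠ 1 := by omega
  have hm3 : d + 1 + 2 ≠ 1 := by omega
  set b := a - c π 2 (d + 1 + 2) with hb
  have hE1 := hπ.isElliptic hm1
  have hE3 := hπ.isElliptic hm3
  have hp : PoleLE d (fun z => f z - π (d + 1 + 2) z - b * π (d + 1) z) := by
    have h1 := IsBigO.sub ha (hπ.hasExpansion hnorm hm3)
    have h2 := (((isBigO_refl (fun z : ℂ => z ^ 2) (𝓝[≠] 0)).mul (hπ.monic _ hm1)).congr_right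
      (g₂ := fun z : ℂ => z ^ 3) (fun z => by ring)).const_mul_left b
    have h3 := (h1.sub h2).mul (isBigO_refl (fun z : ℂ => (z ^ 3)⁻¹) (𝓝[≠] 0))
    refine h3.congr' ?_ ?_
    · filter_upwards [self_mem_nhdsWithin] with z hz
      have hz : z ≠ 0 := hz
      rw [hb]
      field_simp
      ring
    · filter_upwards [self_mem_nhdsWithin] with z hz
      have hz : z ≠ 0 := hz
      field_simp
  have := hπ.innerInt_eq_zero_of_poleLE ((hf.sub hE3).sub (hE1.const_mul b)) hp
    (Nat.lt_succ_self d) hm1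
  rw [innerInt_sub_left (hf.sub hE3) (hE1.const_mul b) hE1, innerInt_sub_left hf hE3 hE1,
    innerInt_const_mul_left, hπ.innerInt_eq_zero hm3 hm1 (by omega), ← h_eq_innerInt] at this
  linear_combination this

end Coefficients

/-! ### Convergence and derivative of `ζ`. -/

section Zeta

/-- The summand collapses to `s² / ((s - l) l²)`, of order `‖l‖⁻³`, which is summable over a lattice
of rank two. -/
lemma norm_zeta_summand_le (r : ℝ) (hr : 0 < r) (s : ℂ) (hs : ‖s‖ < r) (l : ℂ)
    (hl : 2 * r ≤ ‖l‖) :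
    ‖1 / (s - l) + 1 / l + s / l ^ 2‖ ≤ 2 * r ^ 2 * ‖l‖ ^ (-3 : ℝ) := by
  have hl0 : 0 < ‖l‖ := by linarith
  have hl0' : l ≠ 0 := norm_pos_iff.1 hl0
  have hsl : ‖l‖ / 2 ≤ ‖s - l‖ := by
    rw [norm_sub_rev]
    exact .trans (by linarith) (norm_sub_norm_le l s)
  have hsl' : s - l ≠ 0 := norm_pos_iff.1 (by linarith)
  have h1 : 1 / (s - l) + 1 / l + s / l ^ 2 = s ^ 2 / ((s - l) * l ^ 2) := by
    field_simp; ring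
  calc
    _ = ‖s‖ ^ 2 / (‖s - l‖ * ‖l‖ ^ 2) := by rw [h1]; simp
    _ ≤ r ^ 2 / (‖l‖ / 2 * ‖l‖ ^ 2) := by gcongr
    _ = 2 * r ^ 2 / ‖l‖ ^ 3 := by field
    _ = _ := by norm_cast

variable (τ : UpperHalfPlane)

lemma hasSumLocallyUniformly_wzeta :
    HasSumLocallyUniformly
      (fun (l : (periods τ).lattice) (z : ℂ) => 1 / (z - l) + 1 / (l : ℂ) + z / (l : ℂ) ^ 2)
      (wzeta τ) := by
  refine (periods τ).hasSumLocallyUniformly_aux (u := fun r l => 2 * r ^ 2 * ‖l‖ ^ (-3 : ℝ)) _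
    (fun _ _ ↦ (ZLattice.summable_norm_rpow _ _ (by simp; norm_num)).mul_left _) fun r hr ↦
    Filter.eventually_atTop.mpr ⟨2 * r, ?_⟩
  rintro _ h s hs l rfl
  exact norm_zeta_summand_le r hr s hs l h

/-- `ζ' = -℘`. -/
lemma hasDerivAt_wzeta {z : ℂ} (hz : z ∉ (periods τ).lattice) :
    HasDerivAt (wzeta τ) (-wp τ z) z := by
  have hopen : IsOpen ((periods τ).lattice : Set ℂ)ᶜ := (periods τ).isClosed_lattice.isOpen_compl
  have hterm : ∀ (l : (periods τ).lattice) (w : ℂ), w ∉ (periods τ).lattice →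
      HasDerivAt (fun w : ℂ => 1 / (w - l) + 1 / (l : ℂ) + w / (l : ℂ) ^ 2)
        (-(1 / (w - l) ^ 2 - 1 / (l : ℂ) ^ 2)) w := fun l w hw => by
    have hne : w - l ≠ 0 := sub_ne_zero.2 fun e => hw (e ▸ l.2)
    have h1 := ((hasDerivAt_id w).sub_const (l : ℂ)).fun_inv hne
    have h2 := (h1.add_const (1 / (l : ℂ))).add ((hasDerivAt_id w).div_const ((l : ℂ) ^ 2))
    refine (h2.congr_deriv ?_).congr_of_eventuallyEq (.of_forall fun w => ?_)
    · simp only [id]; ring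
    · simp [one_div]
  have hsum := (hasSumLocallyUniformly_wzeta τ).tendstoLocallyUniformlyOn
    (s := ((periods τ).lattice : Set ℂ)ᶜ)
  have hdiff : ∀ s : Finset (periods τ).lattice, DifferentiableOn ℂ (fun w : ℂ =>
      ∑ l ∈ s, (1 / (w - l) + 1 / (l : ℂ) + w / (l : ℂ) ^ 2)) ((periods τ).lattice : Set ℂ)ᶜ :=
    fun s => .fun_sum fun l _ w hw => (hterm l w hw).differentiableAt.differentiableWithinAt
  have h1 := (hsum.differentiableOn (.of_forall hdiff) hopen).differentiableAt (hopen.mem_nhds hz)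
  have h2 := (hsum.deriv (.of_forall hdiff) hopen).tendsto_at hz
  have h3 := ((periods τ).hasSum_weierstrassP z).neg
  rw [show -wp τ z = deriv (wzeta τ) z from ?_]
  · exact h1.hasDerivAt
  -- The termwise derivatives are minus the summands of `℘`, also at `l = 0` because `1 / 0 = 0`.
  refine tendsto_nhds_unique h3 (h2.congr fun s => ?_)
  exact (HasDerivAt.fun_sum fun l _ => hterm l z hz).deriv

end Zeta

/-! ### Differentiation under the integral over `γ`. -/

section ParametricIntegral

variable {τ : UpperHalfPlane} {f g g' : ℂ → ℂ}

/-- The shifted segment stays strictly between the lattice rows at heights `0` and `Im τ`. -/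
lemma path_sub_notMem_lattice {z : ℂ} (hz : ‖z‖ < (τ : ℂ).im / 2) (t : ℝ) :
    (τ : ℂ) / 2 + t - z ∉ (periods τ).lattice := by
  intro hmem
  obtain ⟨m, n, hmn⟩ := PeriodPair.mem_lattice.1 hmem
  have him := congrArg Complex.im hmn
  have hle := abs_le.1 ((Complex.abs_im_le_norm z).trans hz.le)
  have habs := (Complex.abs_im_le_norm z).trans_lt hz
  rw [abs_lt] at habs
  have hτ : 0 < (τ : ℂ).im := τ.im_pos
  simp [periods] at him
  simp only [UpperHalfPlane.coe_im] at *
  have h0 : (0 : ℝ) < n := by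
    by_contra! hcon
    nlinarith
  have h1 : (n : ℝ) < 1 := by
    by_contra! hcon
    nlinarith
  norm_cast at h0 h1
  omega

lemma hasDerivAt_gammaIntegral (hf : IsElliptic (periods τ) f)
    (hg : ∀ z, z ∉ (periods τ).lattice → HasDerivAt g (g' z) z)
    (hg' : ContinuousOn g' ((periods τ).lattice : Set ℂ)ᶜ) {z : ℂ} (hz : ‖z‖ < (τ : ℂ).im / 2) :
    HasDerivAt (fun z => gammaIntegral τ (fun w => f w * g (w - z)))
      (-gammaIntegral τ (fun w => f w * g' (w - z))) z := by
  obtain ⟨r, hzr, hr⟩ := exists_between hz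
  have hgc : ContinuousOn g ((periods τ).lattice : Set ℂ)ᶜ :=
    fun w hw => (hg w hw).continuousAt.continuousWithinAt
  have hcont : ∀ {k : ℂ → ℂ}, ContinuousOn k ((periods τ).lattice : Set ℂ)ᶜ → ∀ {z : ℂ},
      ‖z‖ < (τ : ℂ).im / 2 →
      Continuous (fun t : ℝ => f ((τ : ℂ) / 2 + t) * k ((τ : ℂ) / 2 + t - z)) :=
    fun hk z hz => hf.continuous_path.mul
      (hk.comp_continuous (by fun_prop) (path_sub_notMem_lattice hz))
  have hK : ContinuousOn (fun p : ℂ × ℝ => f ((τ : ℂ) / 2 + p.2) * -g' ((τ : ℂ) / 2 + p.2 - p.1))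
      (Metric.closedBall 0 r ×ˢ Set.Icc 0 1) := by
    refine (hf.continuous_path.comp continuous_snd).continuousOn.mul (ContinuousOn.neg ?_)
    refine hg'.comp (by fun_prop) fun p hp => ?_
    refine path_sub_notMem_lattice (lt_of_le_of_lt ?_ hr) p.2
    simpa using hp.1
  obtain ⟨M, hM⟩ := ((isCompact_closedBall (0 : ℂ) r).prod
    (isCompact_Icc (a := (0 : ℝ)) (b := 1))).exists_bound_of_continuousOn hK
  have key := intervalIntegral.hasDerivAt_integral_of_dominated_loc_of_deriv_le
    (μ := MeasureTheory.volume) (a := 0) (b := 1) (x₀ := z) (s := Metric.ball 0 r)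
    (F := fun z t => f ((τ : ℂ) / 2 + t) * g ((τ : ℂ) / 2 + t - z))
    (F' := fun z t => f ((τ : ℂ) / 2 + t) * -g' ((τ : ℂ) / 2 + t - z)) (bound := fun _ => M)
    (Metric.isOpen_ball.mem_nhds (by simpa using hzr))
    (by
      filter_upwards [Metric.isOpen_ball.mem_nhds (show z ∈ Metric.ball 0 r by simpa using hzr)]
        with w hw
      exact (hcont hgc ((by simpa using hw : ‖w‖ < r).trans hr)).aestronglyMeasurable)
    ((hcont hgc hz).intervalIntegrable _ _)
    (hcont hg'.neg hz).aestronglyMeasurable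
    (.of_forall fun t ht w hw => by
      rw [Set.uIoc_of_le zero_le_one] at ht
      exact hM (w, t) ⟨Metric.ball_subset_closedBall hw, ht.1.le, ht.2⟩)
    intervalIntegrable_const
    (.of_forall fun t ht w hw => by
      have hw' : ‖w‖ < (τ : ℂ).im / 2 := (by simpa using hw : ‖w‖ < r).trans hr
      have h1 : HasDerivAt (fun w => (τ : ℂ) / 2 + t - w) (-1) w :=
        (hasDerivAt_id w).const_sub _
      have h2 := (hg _ (path_sub_notMem_lattice hw' t)).comp w h1
      exact (h2.const_mul _).congr_deriv (by ring))
  refine key.2.congr_deriv ?_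
  simp only [gammaIntegral, mul_neg, intervalIntegral.integral_neg]

lemma analyticAt_iteratedDeriv {x : ℂ} (hf : AnalyticAt ℂ f x) (k : ℕ) :
    AnalyticAt ℂ (iteratedDeriv k f) x := by
  rw [iteratedDeriv_eq_iterate]
  exact hf.iterated_deriv k

lemma IsElliptic.iteratedDeriv {L : PeriodPair} (hf : IsElliptic L f) (k : ℕ) :
    IsElliptic L (iteratedDeriv k f) := by
  refine ⟨fun z hz => ?_, fun l hl z => ?_⟩
  · have ha := hf.1.analyticOnNhd L.isClosed_lattice.isOpen_compl z hz
    exact (analyticAt_iteratedDeriv ha k).differentiableAt.differentiableWithinAt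
  · have := iteratedDeriv_comp_add_const k f l
    rw [show (fun z => f (z + l)) = f from funext (hf.2 l hl)] at this
    exact (congrFun this z).symm

lemma iteratedDeriv_gammaIntegral (hf : IsElliptic (periods τ) f) (hg : IsElliptic (periods τ) g)
    (k : ℕ) {z : ℂ} (hz : ‖z‖ < (τ : ℂ).im / 2) :
    iteratedDeriv k (fun z => gammaIntegral τ (fun w => f w * g (w - z))) z =
      (-1) ^ k * gammaIntegral τ (fun w => f w * iteratedDeriv k g (w - z)) := by
  induction k generalizing z with
  | zero => simp
  | succ k ih =>
    have hev : iteratedDeriv k (fun z => gammaIntegral τ (fun w => f w * g (w - z))) =ᶠ[𝓝 z]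
        fun z => (-1) ^ k * gammaIntegral τ (fun w => f w * iteratedDeriv k g (w - z)) := by
      filter_upwards [(isOpen_lt continuous_norm continuous_const).mem_nhds hz] with w hw
      exact ih hw
    have hd := hasDerivAt_gammaIntegral hf (g := iteratedDeriv k g) (g' := iteratedDeriv (k + 1) g)
      (fun w hw => by
        rw [iteratedDeriv_succ]
        exact ((hg.iteratedDeriv k).differentiableAt hw).hasDerivAt)
      (hg.iteratedDeriv (k + 1)).1.continuousOn hz
    rw [iteratedDeriv_succ, hev.deriv_eq, (hd.const_mul _).deriv]
    ring

end ParametricIntegral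

/-! ### Derivatives of `℘` as monic elliptic polynomials. -/

section NormalizedDerivatives

variable (τ : UpperHalfPlane)

/-- The elliptic polynomial `(-1)ᵏ ℘⁽ᵏ⁾ / (k + 1)!`, with principal part `z⁻ᵏ⁻²`. -/
def wpDeriv (k : ℕ) (z : ℂ) : ℂ := (-1) ^ k / ((k + 1).factorial : ℂ) * iteratedDeriv k (wp τ) z

lemma isElliptic_wpDeriv (k : ℕ) : IsElliptic (periods τ) (wpDeriv τ k) :=
  ((isElliptic_wp τ).iteratedDeriv k).const_mul _

lemma iteratedDeriv_wp (k : ℕ) {z : ℂ} (hz : z ∉ (periods τ).lattice) :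
    iteratedDeriv k (wp τ) z = (-1) ^ k * ((k + 1).factorial : ℂ) / z ^ (k + 2) +
      iteratedDeriv k ((periods τ).weierstrassPExcept 0) z := by
  induction k generalizing z with
  | zero => simp [wp_eq]
  | succ k ih =>
    have hev : iteratedDeriv k (wp τ) =ᶠ[𝓝 z] fun z =>
        (-1) ^ k * ((k + 1).factorial : ℂ) / z ^ (k + 2) +
          iteratedDeriv k ((periods τ).weierstrassPExcept 0) z := by
      filter_upwards [(periods τ).isClosed_lattice.isOpen_compl.mem_nhds hz] with w hw
      exact ih hw
    have hz0 : z ≠ 0 := fun e => hz (e ▸ zero_mem _)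
    have hφ := (analyticAt_iteratedDeriv ((periods τ).analyticOnNhd_weierstrassPExcept 0 z
      (fun h => hz h.1)) k).differentiableAt.hasDerivAt
    have h1 := (((hasDerivAt_pow (k + 2) z).fun_inv (pow_ne_zero _ hz0)).const_mul
      ((-1) ^ k * ((k + 1).factorial : ℂ)))
    rw [iteratedDeriv_succ, iteratedDeriv_succ, hev.deriv_eq]
    simp only [div_eq_mul_inv]
    rw [(h1.fun_add hφ).deriv, Nat.factorial_succ (k + 1), show k + 2 - 1 = k + 1 by omega]
    congr 1
    push_cast
    field_simp
    ring

lemma wpDeriv_eq (k : ℕ) {z : ℂ} (hz : z ∉ (periods τ).lattice) :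
    wpDeriv τ k z = 1 / z ^ (k + 2) + (-1) ^ k / ((k + 1).factorial : ℂ) *
      iteratedDeriv k ((periods τ).weierstrassPExcept 0) z := by
  have hz0 : z ≠ 0 := fun e => hz (e ▸ zero_mem _)
  have hk : ((k + 1).factorial : ℂ) ≠ 0 := by exact_mod_cast (k + 1).factorial_ne_zero
  have h1 : ((-1 : ℂ) ^ k) ^ 2 = 1 := by rw [← pow_mul, mul_comm, pow_mul]; simp
  rw [wpDeriv, iteratedDeriv_wp τ k hz, mul_add]
  congr 1
  field_simp
  linear_combination h1

lemma hasExpansion_wpDeriv (k : ℕ) : HasExpansion (k + 2) (wpDeriv τ k) 0 := by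
  obtain _ | k := k
  · rw [show wpDeriv τ 0 = wp τ by ext z; simp [wpDeriv]]
    exact hasExpansion_wp τ
  · refine HasExpansion.of_analyticAt_add (k := k)
      (v := fun z => (-1) ^ (k + 1) / ((k + 1 + 1).factorial : ℂ) *
        iteratedDeriv (k + 1) ((periods τ).weierstrassPExcept 0) z) ?_ ?_
    · exact analyticAt_const.mul (analyticAt_iteratedDeriv ((periods τ).analyticAt_weierstrassPExcept 0) _)
    · filter_upwards [eventually_notMem_lattice (periods τ)] with z hz
      exact wpDeriv_eq τ (k + 1) hz

end NormalizedDerivatives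

/-! ### Taylor coefficients of the Cauchy transform. -/

section CauchyTransform

variable {τ : UpperHalfPlane} {π : ℕ → ℂ → ℂ} {f : ℂ → ℂ}

lemma eventually_norm_lt (τ : UpperHalfPlane) : ∀ᶠ z : ℂ in 𝓝 0, ‖z‖ < (τ : ℂ).im / 2 := by
  refine (isOpen_lt continuous_norm continuous_const).mem_nhds ?_
  have : 0 < (τ : ℂ).im := τ.im_pos
  simpa using this

lemma hasDerivAt_gammaIntegral_wzeta (hf : IsElliptic (periods τ) f) {z : ℂ}
    (hz : ‖z‖ < (τ : ℂ).im / 2) :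
    HasDerivAt (fun z => gammaIntegral τ (fun w => f w * (wzeta τ (w - z) - wzeta τ w)))
      (gammaIntegral τ (fun w => f w * wp τ (w - z))) z := by
  have hζ : ContinuousOn (wzeta τ) ((periods τ).lattice : Set ℂ)ᶜ :=
    fun w hw => (hasDerivAt_wzeta τ hw).continuousAt.continuousWithinAt
  have h1 := hasDerivAt_gammaIntegral hf (g := wzeta τ) (g' := fun z => -wp τ z)
    (fun w hw => hasDerivAt_wzeta τ hw) (isElliptic_wp τ).1.continuousOn.neg hz
  refine ((h1.sub_const (gammaIntegral τ (fun w => f w * wzeta τ w))).congr_deriv ?_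
    ).congr_of_eventuallyEq ?_
  · simp only [gammaIntegral, mul_neg, intervalIntegral.integral_neg, neg_neg]
  · filter_upwards [(isOpen_lt continuous_norm continuous_const).mem_nhds hz] with w hw
    simp only [gammaIntegral, mul_sub]
    exact intervalIntegral.integral_sub
      ((hf.continuous_path.mul (hζ.comp_continuous (by fun_prop)
        (path_sub_notMem_lattice hw))).intervalIntegrable _ _)
      ((hf.continuous_path.mul (hζ.comp_continuous (by fun_prop)
        (path_notMem_lattice τ))).intervalIntegrable _ _)

/-- The first derivative turns the kernel into `℘(w - z)`; each further one contributes a sign,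
absorbed with the factorial by `wpDeriv`. -/
lemma iteratedDeriv_gammaIntegral_wzeta (hf : IsElliptic (periods τ) f) (k : ℕ) :
    iteratedDeriv (k + 1)
      (fun z => gammaIntegral τ (fun w => f w * (wzeta τ (w - z) - wzeta τ w))) 0 =
      ((k + 1).factorial : ℂ) * innerInt τ (wpDeriv τ k) f := by
  have hev : deriv (fun z => gammaIntegral τ (fun w => f w * (wzeta τ (w - z) - wzeta τ w)))
      =ᶠ[𝓝 0] fun z => gammaIntegral τ (fun w => f w * wp τ (w - z)) := by
    filter_upwards [eventually_norm_lt τ] with z hz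
    exact (hasDerivAt_gammaIntegral_wzeta hf hz).deriv
  have hk : ((k + 1).factorial : ℂ) ≠ 0 := by exact_mod_cast (k + 1).factorial_ne_zero
  rw [iteratedDeriv_succ', hev.iteratedDeriv_eq,
    iteratedDeriv_gammaIntegral hf (isElliptic_wp τ) k (eventually_norm_lt τ).self_of_nhds]
  simp only [sub_zero, innerInt, wpDeriv, mul_assoc, gammaIntegral_const_mul]
  simp only [mul_comm (f _)]
  field_simp

/-- The subleading coefficients of the Cauchy transform of `π_n` are those of `π_{n+2}`. -/
lemma IsEOP.cTilde_two (hπ : IsEOP τ π) (hnorm : ∀ n, n ≠ 1 → h τ π n ≠ 0) {n : ℕ} (hn : 2 ≤ n) :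
    cTilde τ π 2 n = -c π 2 (n + 2) := by
  obtain ⟨d, rfl⟩ : ∃ d, n = d + 1 := ⟨n - 1, by omega⟩
  have hn1 : d + 1 ≠ 1 := by omega
  have hE := hπ.isElliptic hn1
  set U : ℂ → ℂ := fun z =>
    gammaIntegral τ (fun w => π (d + 1) w * (wzeta τ (w - z) - wzeta τ w)) with hU
  have hUa : AnalyticAt ℂ U 0 :=
    Complex.analyticAt_iff_eventually_differentiableAt.2 <| by
      filter_upwards [eventually_norm_lt τ] with z hz
      exact (hasDerivAt_gammaIntegral_wzeta hE hz).differentiableAt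
  -- The subtracted `ζ(w)` settles `i = 0`; for `i ≥ 1` the pairing is with an elliptic polynomial
  -- of degree `i + 1 < d + 1`.
  have hlow : ∀ i < d, iteratedDeriv i U 0 = 0 := by
    intro i hi
    obtain _ | i := i
    · simp [hU, gammaIntegral]
    · rw [hU, iteratedDeriv_gammaIntegral_wzeta hE, hπ.innerInt_eq_zero_of_poleLE
        (isElliptic_wpDeriv τ i) (hasExpansion_wpDeriv τ i).isMonicOfDegree.poleLE
        (by omega) hn1, mul_zero]
  obtain ⟨H, hH, hUH⟩ := (natCast_le_analyticOrderAt hUa).1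
    ((natCast_le_analyticOrderAt_iff_iteratedDeriv_eq_zero hUa).2 hlow)
  have hUH' : U =ᶠ[𝓝 0] fun z => z ^ d * H z := by
    filter_upwards [hUH] with z hz
    simpa using hz
  -- At `0` only the Leibniz term that differentiates `z^d` exactly `d` times survives.
  have htop : iteratedDeriv (d + 2) U 0 =
      ((d + 2).choose d : ℂ) * (d.factorial : ℂ) * iteratedDeriv 2 H 0 := by
    rw [hUH'.iteratedDeriv_eq, iteratedDeriv_fun_mul (by fun_prop) hH.contDiffAt,
      Finset.sum_eq_single d]
    · rw [iteratedDeriv_fun_pow_zero]; simp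
    · intro i _ hi
      rw [iteratedDeriv_fun_pow_zero]; simp [hi]
    · intro hd; simp at hd
  -- `wpDeriv τ (d + 1)` has degree `d + 3` and no `z²` coefficient, so only `-c_{2,d+3} h_{d+1}`
  -- remains.
  rw [hU, iteratedDeriv_gammaIntegral_wzeta hE, hπ.innerInt_of_hasExpansion hnorm hn
    (isElliptic_wpDeriv τ (d + 1)) (hasExpansion_wpDeriv τ (d + 1)), zero_sub] at htop
  have hchoose : ((d + 2).choose d : ℂ) * (d.factorial : ℂ) * 2 = ((d + 1 + 1).factorial : ℂ) := by
    have := Nat.choose_mul_factorial_mul_factorial (show d ≤ d + 2 by omega)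
    rw [Nat.add_sub_cancel_left] at this
    exact_mod_cast this
  have hfact : ((d + 1 + 1).factorial : ℂ) ≠ 0 := by
    exact_mod_cast (d + 1 + 1).factorial_ne_zero
  have hh := hnorm _ hn1
  have hcongr : (fun z => (2 * Real.pi * Complex.I / h τ π (d + 1)) *
      (cauchyTransform τ (π (d + 1)) z / z ^ (d + 1 - 1))) =ᶠ[𝓝[≠] 0]
      fun z => (h τ π (d + 1))⁻¹ * H z := by
    filter_upwards [hUH'.filter_mono nhdsWithin_le_nhds, self_mem_nhdsWithin] with z hz hz0
    have hz0 : z ≠ 0 := hz0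
    have hpi : (Real.pi : ℂ) ≠ 0 := by exact_mod_cast Real.pi_ne_zero
    have hI := Complex.I_ne_zero
    change U z = _ at hz
    rw [show cauchyTransform τ (π (d + 1)) z = U z / (2 * Real.pi * Complex.I) from rfl, hz,
      Nat.add_sub_cancel]
    field_simp
  rw [cTilde, taylorCoeff_eq (v := fun z => (h τ π (d + 1))⁻¹ * H z)
    (analyticAt_const.mul hH) hcongr, iteratedDeriv_const_mul_field]
  have h2 : ((Nat.factorial 2 : ℕ) : ℂ) = 2 := by norm_num
  rw [h2]
  have : ((d + 1 + 1).factorial : ℂ) * (iteratedDeriv 2 H 0 / 2) =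
      ((d + 1 + 1).factorial : ℂ) * (-c π 2 (d + 1 + 2) * h τ π (d + 1)) := by
    rw [htop, ← hchoose]; ring
  have := mul_left_cancel₀ hfact this
  rw [mul_div_assoc, this]
  field_simp

end CauchyTransform

/-! ### The recurrences and the cubic relation. -/

section Recurrence

variable {τ : UpperHalfPlane} {π : ℕ → ℂ → ℂ}

lemma IsMonicOfDegree.sub_poleLE {f g : ℂ → ℂ} {d : ℕ} (hf : IsMonicOfDegree (d + 1) f)
    (hg : IsMonicOfDegree (d + 1) g) : PoleLE d (fun z => f z - g z) :=
  isBigO_one_of_mul ((IsBigO.sub hf hg).congr_left fun z => by ring)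

namespace IsEOP

lemma alpha_eq (hπ : IsEOP τ π) (hnorm : ∀ n, n ≠ 1 → h τ π n ≠ 0) {n : ℕ} (hn : 3 ≤ n) :
    α τ π n = c π 2 n - c π 2 (n + 1) - β τ π n := by
  rw [α, hπ.cTilde_two hnorm (show 2 ≤ n - 1 by omega), show n - 1 + 2 = n + 1 by omega]
  ring

/-- The `β` terms cancel and the coefficients `c_{2,·}` telescope. -/
lemma B_eq (hπ : IsEOP τ π) (hnorm : ∀ n, n ≠ 1 → h τ π n ≠ 0) {n : ℕ} (hn : 3 ≤ n) :
    B τ π n = c π 2 n - c π 2 (n + 2) := by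
  rw [B, hπ.alpha_eq hnorm hn, hπ.alpha_eq hnorm (show 3 ≤ n + 1 by omega)]
  ring

lemma hasExpansion_wp_mul (hπ : IsEOP τ π) (hnorm : ∀ n, n ≠ 1 → h τ π n ≠ 0) {m : ℕ}
    (hm : m ≠ 1) : HasExpansion (m + 2) (fun z => wp τ z * π m z) (c π 2 m) := by
  rw [add_comm]
  exact (hasExpansion_wp τ).mul (hπ.hasExpansion hnorm hm)

lemma hasExpansion_halfDeriv_mul (hπ : IsEOP τ π) (hnorm : ∀ n, n ≠ 1 → h τ π n ≠ 0) {m : ℕ}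
    (hm : m ≠ 1) : HasExpansion (m + 3) (fun z => halfDeriv τ z * π m z) (c π 2 m) := by
  rw [add_comm]
  exact (hasExpansion_halfDeriv τ).mul (hπ.hasExpansion hnorm hm)

lemma isElliptic_wp_mul (hπ : IsEOP τ π) {m : ℕ} (hm : m ≠ 1) :
    IsElliptic (periods τ) (fun z => wp τ z * π m z) :=
  (isElliptic_wp τ).mul (hπ.isElliptic hm)

lemma isElliptic_halfDeriv_mul (hπ : IsEOP τ π) {m : ℕ} (hm : m ≠ 1) :
    IsElliptic (periods τ) (fun z => halfDeriv τ z * π m z) :=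
  (isElliptic_halfDeriv τ).mul (hπ.isElliptic hm)

lemma innerInt_wp_mul_of_lt (hπ : IsEOP τ π) (hnorm : ∀ n, n ≠ 1 → h τ π n ≠ 0) {m n : ℕ}
    (hm : m ≠ 1) (hmn : m + 2 < n) : innerInt τ (fun z => wp τ z * π m z) (π n) = 0 :=
  hπ.innerInt_eq_zero_of_poleLE (hπ.isElliptic_wp_mul hm)
    (hπ.hasExpansion_wp_mul hnorm hm).isMonicOfDegree.poleLE hmn (by omega)

lemma innerInt_wp_mul_add_two (hπ : IsEOP τ π) (hnorm : ∀ n, n ≠ 1 → h τ π n ≠ 0) {m : ℕ}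
    (hm : m ≠ 1) : innerInt τ (fun z => wp τ z * π m z) (π (m + 2)) = h τ π (m + 2) :=
  hπ.innerInt_of_isMonicOfDegree (by omega) (hπ.isElliptic_wp_mul hm)
    (hπ.hasExpansion_wp_mul hnorm hm).isMonicOfDegree

lemma innerInt_wp_mul_self (hπ : IsEOP τ π) (hnorm : ∀ n, n ≠ 1 → h τ π n ≠ 0) {m : ℕ}
    (hm : 2 ≤ m) : innerInt τ (fun z => wp τ z * π m z) (π m) =
      (c π 2 m - c π 2 (m + 2)) * h τ π m :=
  hπ.innerInt_of_hasExpansion hnorm hm (hπ.isElliptic_wp_mul (by omega))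
    (hπ.hasExpansion_wp_mul hnorm (by omega))

lemma innerInt_halfDeriv_mul_of_lt (hπ : IsEOP τ π) (hnorm : ∀ n, n ≠ 1 → h τ π n ≠ 0) {m n : ℕ}
    (hm : m ≠ 1) (hmn : m + 3 < n) : innerInt τ (fun z => halfDeriv τ z * π m z) (π n) = 0 :=
  hπ.innerInt_eq_zero_of_poleLE (hπ.isElliptic_halfDeriv_mul hm)
    (hπ.hasExpansion_halfDeriv_mul hnorm hm).isMonicOfDegree.poleLE hmn (by omega)

lemma innerInt_halfDeriv_mul_add_three (hπ : IsEOP τ π) (hnorm : ∀ n, n ≠ 1 → h τ π n ≠ 0)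
    {m : ℕ} (hm : m ≠ 1) :
    innerInt τ (fun z => halfDeriv τ z * π m z) (π (m + 3)) = h τ π (m + 3) :=
  hπ.innerInt_of_isMonicOfDegree (by omega) (hπ.isElliptic_halfDeriv_mul hm)
    (hπ.hasExpansion_halfDeriv_mul hnorm hm).isMonicOfDegree

lemma innerInt_halfDeriv_mul_add_one (hπ : IsEOP τ π) (hnorm : ∀ n, n ≠ 1 → h τ π n ≠ 0) {m : ℕ}
    (hm : 2 ≤ m) : innerInt τ (fun z => halfDeriv τ z * π m z) (π (m + 1)) =
      (c π 2 m - c π 2 (m + 3)) * h τ π (m + 1) :=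
  hπ.innerInt_of_hasExpansion hnorm (by omega) (hπ.isElliptic_halfDeriv_mul (by omega))
    (hπ.hasExpansion_halfDeriv_mul hnorm (by omega))

lemma innerInt_wp_mul_of_odd (hπ : IsEOP τ π) (hnorm : ∀ n, n ≠ 1 → h τ π n ≠ 0) {m n : ℕ}
    (hm : m ≠ 1) (hn : n ≠ 1) (hmn : Odd (m + n)) :
    innerInt τ (fun z => wp τ z * π m z) (π n) = 0 :=
  innerInt_eq_zero_of_parity (hπ.isElliptic_wp_mul hm) (hπ.isElliptic hn)
    (a := (-1) ^ m) (b := (-1) ^ n) (by rw [← pow_add, hmn.neg_one_pow])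
    (fun z hz => by rw [wp_neg, hπ.comp_neg hnorm hm hz]; ring)
    (fun z hz => hπ.comp_neg hnorm hn hz)

lemma innerInt_halfDeriv_mul_of_even (hπ : IsEOP τ π) (hnorm : ∀ n, n ≠ 1 → h τ π n ≠ 0)
    {m n : ℕ} (hm : m ≠ 1) (hn : n ≠ 1) (hmn : Even (m + n)) :
    innerInt τ (fun z => halfDeriv τ z * π m z) (π n) = 0 :=
  innerInt_eq_zero_of_parity (hπ.isElliptic_halfDeriv_mul hm) (hπ.isElliptic hn)
    (a := (-1) ^ (m + 1)) (b := (-1) ^ n)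
    (by rw [← pow_add, show m + 1 + n = m + n + 1 by ring, hmn.add_one.neg_one_pow])
    (fun z hz => by rw [halfDeriv_neg, hπ.comp_neg hnorm hm hz]; ring)
    (fun z hz => hπ.comp_neg hnorm hn hz)

lemma beta_mul_beta (hnorm : ∀ n, n ≠ 1 → h τ π n ≠ 0) {n : ℕ} (hn : 3 ≤ n) :
    β τ π n * β τ π (n - 1) = h τ π n / h τ π (n - 2) := by
  have h1 := hnorm (n - 1) (by omega)
  rw [β, β, Nat.sub_sub, div_mul_div_cancel₀ h1]

/-- The three-term recurrence for multiplication by `℘`. -/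
theorem recurrence (hπ : IsEOP τ π) (hnorm : ∀ n, n ≠ 1 → h τ π n ≠ 0) {n : ℕ} (hn : 4 ≤ n)
    {z : ℂ} (hz : z ∉ (periods τ).lattice) :
    π (n + 2) z = (wp τ z - B τ π n) * π n z - β τ π n * β τ π (n - 1) * π (n - 2) z := by
  obtain ⟨k, rfl⟩ : ∃ k, n = k + 2 := ⟨n - 2, by omega⟩
  have hk : k ≠ 1 := by omega
  have e1 := hπ.isElliptic (show k + 2 + 2 ≠ 1 by omega)
  have e2 := hπ.isElliptic_wp_mul (show k + 2 ≠ 1 by omega)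
  have e3 := (hπ.isElliptic (show k + 2 ≠ 1 by omega)).const_mul (B τ π (k + 2))
  have e4 := (hπ.isElliptic hk).const_mul (h τ π (k + 2) / h τ π k)
  have hhk := hnorm k hk
  -- With `n = k + 2` the leading terms cancel, leaving degree at most `n + 1`. For `m ≤ n - 2` of
  -- the parity of `n`, `℘` is moved onto `π_m`; `m = n` fixes `B_n`.
  have key := hπ.eq_zero_of_innerInt_eq_zero hnorm (d := k + 3) (((e1.sub e2).add e3).add e4)
    (((((hπ.monic _ (show k + 2 + 2 ≠ 1 by omega)).sub_poleLE
      (hπ.hasExpansion_wp_mul hnorm (show k + 2 ≠ 1 by omega)).isMonicOfDegree)).add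
        (((hπ.monic (k + 2) (by omega)).poleLE.const_mul _).mono (by omega))).add
        (((hπ.monic k hk).poleLE.const_mul _).mono (by omega)))
    (fun m hm hm1 => by
      have em := hπ.isElliptic hm1
      rw [innerInt_add_left ((e1.sub e2).add e3) e4 em, innerInt_add_left (e1.sub e2) e3 em,
        innerInt_sub_left e1 e2 em, innerInt_const_mul_left, innerInt_const_mul_left,
        hπ.innerInt_eq_zero (by omega) hm1 (show k + 2 + 2 ≠ m by omega)]
      rcases Nat.even_or_odd (k + 2 + m) with hpar | hpar
      · rcases lt_trichotomy m k with hlt | rfl | hlt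
        · rw [innerInt_mul_left, hπ.innerInt_wp_mul_of_lt hnorm hm1 (by omega),
            hπ.innerInt_eq_zero (by omega) hm1 (by omega),
            hπ.innerInt_eq_zero (by omega) hm1 (by omega)]
          ring
        · rw [innerInt_mul_left, hπ.innerInt_wp_mul_add_two hnorm hm1,
            hπ.innerInt_eq_zero (by omega) hm1 (by omega), ← h_eq_innerInt]
          field_simp
          ring
        · obtain rfl : m = k + 2 := by
            obtain ⟨r, hr⟩ := hpar
            omega
          rw [hπ.innerInt_wp_mul_self hnorm (by omega), ← h_eq_innerInt,
            hπ.innerInt_eq_zero hk hm1 (by omega), hπ.B_eq hnorm (by omega)]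
          ring
      · obtain ⟨r, hr⟩ := hpar
        rw [hπ.innerInt_wp_mul_of_odd hnorm (by omega) hm1 ⟨r, hr⟩,
          hπ.innerInt_eq_zero (by omega) hm1 (by omega),
          hπ.innerInt_eq_zero (by omega) hm1 (by omega)]
        ring) z hz
  rw [beta_mul_beta hnorm (by omega), Nat.add_sub_cancel]
  linear_combination key

/-- The relation for multiplication by `-℘' / 2`. -/
theorem halfDeriv_mul (hπ : IsEOP τ π) (hnorm : ∀ n, n ≠ 1 → h τ π n ≠ 0) {n : ℕ} (hn : 3 ≤ n)
    {z : ℂ} (hz : z ∉ (periods τ).lattice) :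
    halfDeriv τ z * π n z = (wp τ z + α τ π n) * π (n + 1) z +
      β τ π n * ((wp τ z + α τ π (n + 1)) * π (n - 1) z) := by
  have ha := hπ.alpha_eq hnorm hn
  have ha' := hπ.alpha_eq hnorm (show 3 ≤ n + 1 by omega)
  obtain ⟨k, rfl⟩ : ∃ k, n = k + 3 := ⟨n - 3, by omega⟩
  have hβ : β τ π (k + 3) = h τ π (k + 3) / h τ π (k + 2) := rfl
  have hβ' : β τ π (k + 3 + 1) = h τ π (k + 4) / h τ π (k + 3) := rfl
  have hh2 := hnorm (k + 2) (by omega)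
  have hh3 := hnorm (k + 3) (by omega)
  have e1 := hπ.isElliptic_wp_mul (show k + 4 ≠ 1 by omega)
  have e2 := hπ.isElliptic_halfDeriv_mul (show k + 3 ≠ 1 by omega)
  have e3 := (hπ.isElliptic (show k + 4 ≠ 1 by omega)).const_mul (α τ π (k + 3))
  have e4 := (hπ.isElliptic_wp_mul (show k + 2 ≠ 1 by omega)).const_mul (β τ π (k + 3))
  have e5 := (hπ.isElliptic (show k + 2 ≠ 1 by omega)).const_mul
    (β τ π (k + 3) * α τ π (k + 3 + 1))
  -- With `n = k + 3`, `℘ π_{n+1}` and `-℘'/2 π_n` share their leading term, leaving degree at most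
  -- `n + 2`. Parity removes half of the tests; `m = n - 3` fixes `β_n`, `m = n - 1` fixes
  -- `α_{n+1}`, and `m = n + 1` fixes `α_n`.
  have key := hπ.eq_zero_of_innerInt_eq_zero hnorm (d := k + 5)
    ((((e1.sub e2).add e3).add e4).add e5)
    (((((((hπ.hasExpansion_wp_mul hnorm (show k + 4 ≠ 1 by omega)).isMonicOfDegree).sub_poleLE
      (hπ.hasExpansion_halfDeriv_mul hnorm (show k + 3 ≠ 1 by omega)).isMonicOfDegree)).add
        (((hπ.monic (k + 4) (by omega)).poleLE.const_mul _).mono (by omega))).add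
        (((hπ.hasExpansion_wp_mul hnorm (show k + 2 ≠ 1 by omega)
          ).isMonicOfDegree.poleLE.const_mul _).mono (by omega))).add
        (((hπ.monic (k + 2) (by omega)).poleLE.const_mul _).mono (by omega)))
    (fun m hm hm1 => by
      have em := hπ.isElliptic hm1
      rw [innerInt_add_left (((e1.sub e2).add e3).add e4) e5 em,
        innerInt_add_left ((e1.sub e2).add e3) e4 em, innerInt_add_left (e1.sub e2) e3 em,
        innerInt_sub_left e1 e2 em, innerInt_const_mul_left, innerInt_const_mul_left,
        innerInt_const_mul_left]
      rcases Nat.even_or_odd (k + 3 + m) with hpar | hpar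
      · obtain ⟨r, hr⟩ := hpar
        rw [hπ.innerInt_halfDeriv_mul_of_even hnorm (by omega) hm1 ⟨r, hr⟩,
          hπ.innerInt_wp_mul_of_odd hnorm (by omega) hm1 ⟨r, by omega⟩,
          hπ.innerInt_wp_mul_of_odd hnorm (by omega) hm1 ⟨r - 1, by omega⟩,
          hπ.innerInt_eq_zero (by omega) hm1 (by omega),
          hπ.innerInt_eq_zero (by omega) hm1 (by omega)]
        ring
      · obtain ⟨r, hr⟩ := hpar
        have hcases : m < k ∨ m = k ∨ m = k + 2 ∨ m = k + 4 := by omega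
        rcases hcases with hlt | rfl | rfl | rfl
        · rw [innerInt_mul_left, hπ.innerInt_wp_mul_of_lt hnorm hm1 (by omega),
            innerInt_mul_left (π (k + 3)), hπ.innerInt_halfDeriv_mul_of_lt hnorm hm1 (by omega),
            innerInt_mul_left (π (k + 2)), hπ.innerInt_wp_mul_of_lt hnorm hm1 (by omega),
            hπ.innerInt_eq_zero (by omega) hm1 (by omega),
            hπ.innerInt_eq_zero (by omega) hm1 (by omega)]
          ring
        · rw [innerInt_mul_left, hπ.innerInt_wp_mul_of_lt hnorm hm1 (by omega),
            innerInt_mul_left (π (m + 3)), hπ.innerInt_halfDeriv_mul_add_three hnorm hm1,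
            innerInt_mul_left (π (m + 2)), hπ.innerInt_wp_mul_add_two hnorm hm1,
            hπ.innerInt_eq_zero (by omega) hm1 (by omega),
            hπ.innerInt_eq_zero (by omega) hm1 (by omega), hβ]
          field_simp
          ring
        · rw [innerInt_mul_left, hπ.innerInt_wp_mul_add_two hnorm hm1,
            innerInt_mul_left (π (k + 3)), hπ.innerInt_halfDeriv_mul_add_one hnorm (by omega),
            hπ.innerInt_wp_mul_self hnorm (by omega),
            hπ.innerInt_eq_zero (by omega) hm1 (by omega), ← h_eq_innerInt, ha', hβ, hβ']
          field_simp
          ring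
        · have hz2 := hπ.innerInt_wp_mul_add_two hnorm (m := k + 2) (by omega)
          rw [hπ.innerInt_wp_mul_self hnorm (by omega),
            hπ.innerInt_halfDeriv_mul_add_one hnorm (by omega), hz2, ← h_eq_innerInt,
            hπ.innerInt_eq_zero (by omega) hm1 (show k + 2 ≠ k + 4 by omega), ha]
          ring) z hz
  simp only [show k + 3 - 1 = k + 2 by omega, show k + 3 + 1 = k + 4 by omega] at key ⊢
  linear_combination -key

/-- The relation between `α_{n-1}`, `α_n` and `α_{n+1}`. -/
theorem alpha_relation (hπ : IsEOP τ π) (hnorm : ∀ n, n ≠ 1 → h τ π n ≠ 0) {n : ℕ} (hn : 4 ≤ n) :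
    -(α τ π n) ^ 3 + (periods τ).g₂ / 4 * α τ π n - (periods τ).g₃ / 4 =
      β τ π n * (α τ π (n - 1) - α τ π n) * (α τ π (n + 1) - α τ π n) := by
  -- `p` is the difference of the two expressions for `(℘'/2)²` as polynomials in `X = ℘`, so `p(℘)
  -- π_n = 0`. The relation at `n - 1` is used, whence `n ≥ 4`.
  open Polynomial in
  let p : ℂ[X] := X ^ 3 - C ((periods τ).g₂ / 4) * X - C ((periods τ).g₃ / 4)
    - (X + C (α τ π n)) * ((X + C (α τ π (n + 1))) * (X - C (B τ π n))
      + C (β τ π (n + 1)) * (X + C (α τ π (n + 2))))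
    - C (β τ π n) * (X + C (α τ π (n + 1))) * (X + C (α τ π (n - 1)))
  have hp : ∀ᶠ z in 𝓝[≠] (0 : ℂ), p.eval (wp τ z) = 0 := by
    have hne : ∀ᶠ z in 𝓝[≠] (0 : ℂ), π n z ≠ 0 := by
      have h0 : Tendsto (fun z : ℂ => z) (𝓝[≠] 0) (𝓝 0) := tendsto_id.mono_left nhdsWithin_le_nhds
      have h1 := IsBigO.trans_tendsto (hπ.monic n (by omega)) h0
      filter_upwards [h1.eventually_ne (show (0 : ℂ) ≠ -1 by norm_num)] with z hz hzero
      simp [hzero] at hz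
    filter_upwards [hne, eventually_notMem_lattice (periods τ)] with z hzne hz
    have r0 := hπ.halfDeriv_mul hnorm (show 3 ≤ n by omega) hz
    have r1 := hπ.halfDeriv_mul hnorm (show 3 ≤ n + 1 by omega) hz
    have r2 := hπ.halfDeriv_mul hnorm (show 3 ≤ n - 1 by omega) hz
    have r3 := hπ.recurrence hnorm hn hz
    have r4 := halfDeriv_sq τ hz
    simp only [Nat.add_sub_cancel, Nat.sub_add_cancel (show 1 ≤ n by omega), Nat.sub_sub]
      at r0 r1 r2
    refine (mul_eq_zero.1 ?_).resolve_right hzne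
    simp only [p, Polynomial.eval_sub, Polynomial.eval_add, Polynomial.eval_mul,
      Polynomial.eval_pow, Polynomial.eval_X, Polynomial.eval_C]
    linear_combination (-π n z) * r4 + halfDeriv τ z * r0 + (wp τ z + α τ π n) * r1
      + β τ π n * (wp τ z + α τ π (n + 1)) * r2
      + (wp τ z + α τ π n) * (wp τ z + α τ π (n + 1)) * r3
  have hp0 : p = 0 := by
    by_contra hne
    have hfin : Bornology.IsBounded {x | p.IsRoot x} :=
      (Polynomial.finite_setOfPred_isRoot hne).isBounded
    have hinf : Tendsto (wp τ) (𝓝[≠] 0) (Bornology.cobounded ℂ) :=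
      tendsto_cobounded_of_meromorphicOrderAt_neg (by
        rw [wp, (periods τ).order_weierstrassP 0 (zero_mem _)]; decide)
    -- Near its pole `℘` leaves the bounded root set of a nonzero `p`.
    obtain ⟨z, h1, h2⟩ := (hp.and (hinf.eventually hfin)).exists
    exact h2 h1
  -- At `X = -α_n` the term involving `B_n`, `β_{n+1}` and `α_{n+2}` drops out.
  have := congrArg (Polynomial.eval (-α τ π n)) hp0
  simp only [p, Polynomial.eval_sub, Polynomial.eval_add, Polynomial.eval_mul,
    Polynomial.eval_pow, Polynomial.eval_X, Polynomial.eval_C, Polynomial.eval_zero] at this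
  linear_combination this

end IsEOP

end Recurrence

end EllipticOP

end

theorem theorem3p4 (τ : UpperHalfPlane) (π : ℕ → ℂ → ℂ)
    (hπ : EllipticOP.IsEOP τ π)
    (hnorm : ∀ n, n ≠ 1 → EllipticOP.h τ π n ≠ 0)
    (n : ℕ) (hn : 4 ≤ n) :
    (∀ z : ℂ, z ∉ (EllipticOP.periods τ).lattice →
      π (n + 2) z =
        (EllipticOP.wp τ z - EllipticOP.B τ π n) * π n z
          - EllipticOP.β τ π n * EllipticOP.β τ π (n - 1) * π (n - 2) z) ∧
    -(EllipticOP.α τ π n) ^ 3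
        + (EllipticOP.periods τ).g₂ / 4 * EllipticOP.α τ π n
        - (EllipticOP.periods τ).g₃ / 4 =
      EllipticOP.β τ π n
        * (EllipticOP.α τ π (n - 1) - EllipticOP.α τ π n)
        * (EllipticOP.α τ π (n + 1) - EllipticOP.α τ π n) :=
  ⟨fun _ hz => hπ.recurrence hnorm hn hz, hπ.alpha_relation hnorm hn⟩
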